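/- Fix an integer $n\ge 3$. For every $p>n$ let $X_1^{(p)},\dots,X_n^{(p)}$ be i.i.d. random vectors in $\mathbb{R}^p$, all defined on one probability space, with an absolutely continuous distribution with mean $\mu^{(p)}$ and positive definite covariance matrix $\Sigma^{(p)}=\sum_{i=1}^p\lambda_iu_iu_i^{\top}$, where $u_1,\dots,u_p$ are orthonormal and $\lambda_1\ge\dots\ge\lambda_p$ (the dependence of $\lambda_i,u_i$ on $p$ is suppressed). Assume: (1) (single spike) $\lambda_1=\sigma_1^2p+\tau_1^2$ and $\lambda_i=\tau_i^2$ for $2\le i\le p$, where $\sigma_1^2>0$ is constant, the $\tau_i^2>0$ (which may depend on $p$) are uniformly bounded, and $\frac1p\sum_{i=1}^p\tau_i^2\to\tau^2$ as $p\to\infty$ for a constant $\tau^2>0$; (2) for every $j=1,\dots,n$ the standardized scores $z_{ij}=\lambda_i^{-1/2}u_i^{\top}(X_j^{(p)}-\mu^{(p)})$, $i\le p$, are, for each $p$, a truncation of one infinite sequence $z_{1j},z_{2j},\dots$ not depending on $p$; this sequence is $\rho$-mixing after some permutation of its indices, and the fourth moments of the $z_{ij}$ are uniformly bounded; (3) (single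 reference direction) $v_1=v_1^{(p)}\in\mathbb{R}^p$ are deterministic unit vectors, $|v_1^{\top}u_1|=\|P_{\operatorname{span}(u_1)}v_1\|\to a_1\in[0,1]$, and $v_1^{\top}u_1$ converges to a constant $a_{11}\in[-1,1]$, as $p\to\infty$. Let $S=\frac1n\sum_{j}(X_j-\bar X)(X_j-\bar X)^{\top}=\sum_{i=1}^{n-1}\hat\lambda_i\hat u_i\hat u_i^{\top}$ be an eigendecomposition of the sample covariance matrix with $\hat\lambda_1\ge\dots\ge\hat\lambda_{n-1}$, orthonormal $\hat u_i$ and signs such that $\hat u_i^{\top}u_i\ge0$. Put $\tilde\lambda=\frac1{n-2}\sum_{i=2}^{n-1}\hat\lambda_i$ and $d_1=-\tilde\lambda(\hat\lambda_1\hat u_1\hat u_1^{\top}-\tilde\lambda I_p)^{-1}v_1$. The ARG estimator $\hat u_1^{ARG}$ is a unit vector in the orthogonal complement of $d_1$ within $\operatorname{span}(\hat u_1,v_1)$, with sign such that $(\hat u_1^{ARG})^{\top}u_1\ge0$. Let $\Omega=\sigma_1^2z_1^{\top}(I_n-\frac1n1_n1_n^{\top})z_1$ with $z_1=(z_{11},\dots,z_{1n})^{\top}$.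 Then, as $p\to\infty$, $$(\hat u_1^{ARG})^{\top}u_1\xrightarrow{P}\sqrt{\Big(\frac{\Omega}{\Omega+\tau^2}\Big)\Big(1+\frac{\tau^4a_1^2}{\Omega^2(1-a_1^2)+\Omega\tau^2}\Big)}.$$ Consequently $\hat u_1^{ARG}$ is asymptotically closer to $u_1$ than $\hat u_1$, in the following sense: $\hat u_1^{\top}u_1\xrightarrow{P}\sqrt{\Omega/(\Omega+\tau^2)}$ and $$\frac{(\hat u_1^{ARG})^{\top}u_1}{\hat u_1^{\top}u_1}\xrightarrow{P}\sqrt{1+\frac{\tau^4a_1^2}{\Omega^2(1-a_1^2)+\Omega\tau^2}},$$ where the term inside the last square root is almost surely at least $1$; for every $\varepsilon>0$, $\mathbb{P}\big(\operatorname{Angle}(\hat u_1^{ARG},u_1)<\operatorname{Angle}(\hat u_1,u_1)+\varepsilon\big)\to1$; and if $a_1>0$, that term is almost surely greater than $1$ and $\mathbb{P}\big(\operatorname{Angle}(\hat u_1^{ARG},u_1)<\operatorname{Angle}(\hat u_1,u_1)\big)\to1$. -/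

import Mathlib

open MeasureTheory ProbabilityTheory Filter Topology
open scoped RealInnerProductSpace ENNReal

/-! All families are indexed from `0`: the mathematical `i`-th object has index `i - 1`. -/

noncomputable section

namespace ARG

/-- Column vectors of length `p`, with the Euclidean inner product and norm. -/
abbrev Vec (p : ℕ) := EuclideanSpace ℝ (Fin p)

/-! ### Rho-mixing -/

section RhoMixing

variable {Ω : Type*} [MeasurableSpace Ω]

/-- The maximal correlation `ρ(𝒜, ℬ) = sup |Corr (f, g)|` over square-integrable `f`, `g` measurable
with respect to `𝒜`, `ℬ`. Pairs with a degenerate member contribute `0`. -/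
def maxCorr (P : Measure Ω) (𝒜 ℬ : MeasurableSpace Ω) : ℝ≥0∞ :=
  ⨆ (f : Ω → ℝ) (g : Ω → ℝ) (_ : Measurable[𝒜] f) (_ : Measurable[ℬ] g)
    (_ : MemLp f 2 P) (_ : MemLp g 2 P),
    ENNReal.ofReal (|cov[f, g; P]| / (√Var[f; P] * √Var[g; P]))

/-- The σ-algebra generated by `ξ 0, …, ξ j`. -/
@[reducible] def past (ξ : ℕ → Ω → ℝ) (j : ℕ) : MeasurableSpace Ω :=
  ⨆ k, ⨆ (_ : k ≤ j), MeasurableSpace.comap (ξ k) inferInstance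

/-- The σ-algebra generated by `ξ j, ξ (j + 1), …`. -/
@[reducible] def future (ξ : ℕ → Ω → ℝ) (j : ℕ) : MeasurableSpace Ω :=
  ⨆ k, ⨆ (_ : j ≤ k), MeasurableSpace.comap (ξ k) inferInstance

/-- The mixing coefficient at lag `d`. -/
def rhoCoeff (P : Measure Ω) (ξ : ℕ → Ω → ℝ) (d : ℕ) : ℝ≥0∞ :=
  ⨆ j, maxCorr P (past ξ j) (future ξ (j + d))

/-- The sequence `ξ` is ρ-mixing under `P`. -/
def IsRhoMixing (P : Measure Ω) (ξ : ℕ → Ω → ℝ) : Prop :=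
  Tendsto (rhoCoeff P ξ) atTop (𝓝 0)

end RhoMixing

/-! ### The population -/

/-- `X 0, …, X (n-1)` is an i.i.d. sample from an absolutely continuous distribution on `ℝᵖ` with
mean `μ` and positive definite covariance matrix `C`. -/
structure IsSample {Ω : Type*} [MeasurableSpace Ω] (P : Measure Ω) {n p : ℕ}
    (X : Fin n → Ω → Vec p) (μ : Vec p) (C : Matrix (Fin p) (Fin p) ℝ) : Prop where
  measurable : ∀ i, Measurable (X i)
  indep : iIndepFun X P
  identDistrib : ∀ i j, IdentDistrib (X i) (X j) P P
  absolutelyContinuous : ∀ i, P.map (X i) ≪ volume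
  memLp : ∀ i, MemLp (X i) 2 P
  mean : ∀ i, ∫ ω, X i ω ∂P = μ
  cov : ∀ i a b, cov[fun ω => X i ω a, fun ω => X i ω b; P] = C a b
  posDef : C.PosDef

/-- `C = ∑ₖ lam k • u k (u k)ᵀ` is an eigendecomposition with ordered eigenvalues. Only the indices
`k < p` matter. -/
structure IsEigendecomposition {p : ℕ} (C : Matrix (Fin p) (Fin p) ℝ) (lam : ℕ → ℝ)
    (u : ℕ → Vec p) : Prop where
  orthonormal : Orthonormal ℝ (fun k : Fin p => u k)
  antitone : ∀ k l, k ≤ l → l < p → lam l ≤ lam k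
  eq_sum : C = ∑ k ∈ Finset.range p, lam k • Matrix.vecMulVec (u k) (u k)

/-- The spiked covariance model with one spike: in dimension `p > n` the eigenvalues are
`lam p 0 = σ² p + τ₁²` and `lam p k = τₖ²` for `k ≥ 1` (the `τₖ²` may vary with `p`), the `τₖ²` being
positive and uniformly bounded with averages tending to `τ² > 0`. -/
structure SingleSpike (n : ℕ) (lam : ℕ → ℕ → ℝ) (σsq τsq : ℝ) (τs : ℕ → ℕ → ℝ) : Prop where
  size : 1 ≤ n - 2
  σsq_pos : 0 < σsq
  τs_pos : ∀ p, n < p → ∀ k, k < p → 0 < τs p k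
  spiked : ∀ p, n < p → lam p 0 = σsq * p + τs p 0
  nonspiked : ∀ p, n < p → ∀ k, 1 ≤ k → k < p → lam p k = τs p k
  bounded : ∃ B : ℝ, ∀ p, n < p → ∀ k, k < p → τs p k ≤ B
  average : Tendsto (fun p : ℕ => (∑ k ∈ Finset.range p, τs p k) / p) atTop (𝓝 τsq)
  τsq_pos : 0 < τsq

/-- The assumption on the standardized true principal component scores
`(lam p k)^(-1/2) (u p k)ᵀ (X p i - μ p)`: for every `i` they are, for each `p`, the truncation of
one infinite sequence `z 0 i, z 1 i, …`, which has uniformly bounded fourth moments and is ρ-mixing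
under some permutation. -/
structure ScoreCondition {Ω : Type*} [MeasurableSpace Ω] (P : Measure Ω) {n : ℕ}
    (X : (p : ℕ) → Fin n → Ω → Vec p) (μ : (p : ℕ) → Vec p) (lam : ℕ → ℕ → ℝ)
    (u : (p : ℕ) → ℕ → Vec p) (z : ℕ → Fin n → Ω → ℝ) : Prop where
  truncation : ∀ p, n < p → ∀ k, k < p → ∀ i ω,
    (√(lam p k))⁻¹ * ⟪u p k, X p i ω - μ p⟫ = z k i ω
  fourthMoment : ∃ B : ℝ, ∀ k i, ∫⁻ ω, ENNReal.ofReal ((z k i ω) ^ 4) ∂P ≤ ENNReal.ofReal B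
  rhoMixing : ∀ i, ∃ π : Equiv.Perm ℕ, IsRhoMixing P (fun k => z (π k) i)

/-- `σ² zᵀ (I - J) z` with `J = 1 1ᵀ / n`. -/
def spikeScatter {n : ℕ} (σsq : ℝ) (z : Fin n → ℝ) : ℝ :=
  σsq * (z ⬝ᵥ ((1 - (n : ℝ)⁻¹ • Matrix.of fun _ _ => (1 : ℝ)) : Matrix (Fin n) (Fin n) ℝ).mulVec z)

/-- The assumption on a reference direction in the case of one spike and one reference direction:
the `v p` are unit vectors, the norm of the projection of `v p` onto the span of `u p 0` tends to
`a₁`, and `(v p)ᵀ (u p 0)` tends to a constant. -/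
structure ReferenceCondition (n : ℕ) (u : (p : ℕ) → ℕ → Vec p) (v : (p : ℕ) → Vec p)
    (a₁ : ℝ) : Prop where
  unit : ∀ p, n < p → ‖v p‖ = 1
  mem_Icc : a₁ ∈ Set.Icc (0 : ℝ) 1
  projection : Tendsto (fun p => ‖(Submodule.span ℝ {u p 0}).starProjection (v p)‖) atTop (𝓝 a₁)
  inner : ∃ a₁₁ ∈ Set.Icc (-1 : ℝ) 1, Tendsto (fun p => ⟪v p, u p 0⟫) atTop (𝓝 a₁₁)

/-! ### The sample estimators -/

/-- The sample mean. -/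
def sampleMean {n p : ℕ} (x : Fin n → Vec p) : Vec p := (n : ℝ)⁻¹ • ∑ i, x i

/-- The sample covariance matrix, normalized by `1 / n`. -/
def sampleCov {n p : ℕ} (x : Fin n → Vec p) : Matrix (Fin p) (Fin p) ℝ :=
  (n : ℝ)⁻¹ • ∑ i, Matrix.vecMulVec (x i - sampleMean x) (x i - sampleMean x)

/-- `(lamHat k, uHat k)`, `k < n - 1`, are the sample principal component variances and directions
of the data `x` : `S = ∑ₖ lamHat k • uHat k (uHat k)ᵀ` with ordered `lamHat`, orthonormal `uHat`, and
signs chosen so that `(uHat k)ᵀ (u k) ≥ 0`. -/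
structure IsSamplePCA {n p : ℕ} (x : Fin n → Vec p) (u : ℕ → Vec p) (lamHat : ℕ → ℝ)
    (uHat : ℕ → Vec p) : Prop where
  orthonormal : Orthonormal ℝ (fun k : Fin (n - 1) => uHat k)
  antitone : ∀ k l, k ≤ l → l < n - 1 → lamHat l ≤ lamHat k
  eq_sum : sampleCov x = ∑ k ∈ Finset.range (n - 1), lamHat k • Matrix.vecMulVec (uHat k) (uHat k)
  sign : ∀ k, k < n - 1 → 0 ≤ ⟪uHat k, u k⟫

/-- The average of the `n - 2` non-spiked sample eigenvalues (one spike). -/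
def ridgeParam (n : ℕ) (lamHat : ℕ → ℝ) : ℝ :=
  (∑ k ∈ Finset.Ico 1 (n - 1), lamHat k) / ((n : ℝ) - 2)

/-- The negatively ridged discriminant vector `-λ (S₁ - λ I)⁻¹ v` with `λ = ridgeParam n lamHat` and
`S₁ = lamHat 0 • uHat 0 (uHat 0)ᵀ`. -/
def ridgedDiscriminant (n : ℕ) {p : ℕ} (lamHat : ℕ → ℝ) (uHat : ℕ → Vec p) (v : Vec p) : Vec p :=
  -(ridgeParam n lamHat) • WithLp.toLp 2
    ((lamHat 0 • Matrix.vecMulVec (uHat 0) (uHat 0) -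
      ridgeParam n lamHat • (1 : Matrix (Fin p) (Fin p) ℝ))⁻¹.mulVec v)

/-- `w` is a unit vector in the orthogonal complement of the negatively ridged discriminant vector
inside the signal subspace `span (uHat 0, v)`, with the sign chosen so that `wᵀ u₁ ≥ 0`. -/
structure IsARGDirection (n : ℕ) {p : ℕ} (lamHat : ℕ → ℝ) (uHat : ℕ → Vec p) (v u₁ w : Vec p) :
    Prop where
  mem : w ∈ Submodule.span ℝ {uHat 0, v} ⊓
    (Submodule.span ℝ {ridgedDiscriminant n lamHat uHat v})ᗮ
  unit : ‖w‖ = 1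
  sign : 0 ≤ ⟪w, u₁⟫

/-- The factor `1 + τ⁴ a² / (s² (1 - a²) + s τ²)`. -/
def gain (τsq a s : ℝ) : ℝ := 1 + τsq ^ 2 * a ^ 2 / (s ^ 2 * (1 - a ^ 2) + s * τsq)

end ARG

end

noncomputable section

namespace ARG

/-! ### Convergence to zero of the measures of possibly non-measurable events -/

/-! Only the spike scores `z 0 i` stay random in the limit. Up to finitely many errors that tend to
zero in probability, every sample quantity is governed by these `n` numbers. The proof therefore
splits into a deterministic limit, taken with the spike scores near a fixed `ζ` and the errors near
zero, and a transfer principle. The transfer uses compactness for uniformity in `ζ` and inner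
regularity of the law of the scores. It needs no measurability of the sample eigenvectors or of the
ARG direction, which are arbitrary selections.

Errors. They are the fluctuations of the bulk Gram matrix around `τ² I` and the non-spiked part of
the data along `v`. Chebyshev's inequality handles both. Diagonal Gram entries need averaged
covariances of squared scores, small by ρ-mixing; off-diagonal entries need only independence of two
observations and uncorrelated scores; the part along `v` has variance `O(1/p)` by Bessel.

Deterministic limit. With `J = 1 1ᵀ / n` and `ζ` centered, the centered Gram matrix divided by `p`
tends to `σ² ζ ζᵀ + τ² (I - J)`, so its top eigenvalue tends to `Ω + τ²` and, by the trace, the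
average of the other `n - 2` eigenvalues tends to `τ²`. Testing quadratic forms, without convergence
of eigenvectors, gives the cosines `b → √(Ω / (Ω + τ²))` of `uHat 0` with `u₁` and `c → a b` of
`uHat 0` with `v`, where `a = lim vᵀ u₁`.

ARG direction. In the plane of `uHat 0` and `v`, orthogonality to the discriminant vector and unit
length fix the direction up to sign, so its cosine with `u₁` is an explicit function of `a`, `b`,
`c` and `κ = lam / (lamHat 0 - lam) → τ² / Ω`. In the limit this function is `b G / √G = b √G`, with
`G` the gain factor.

Absolute continuity makes `Ω` almost surely positive. The angle statements follow from continuity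
and strict monotonicity of arccos, from `G ≥ 1`, and from `G > 1` when `a₁ > 0`. -/

/-- The pairs `(p, ω)` with `p` large, all errors `e i p ω` small, and `Y ω` close to `y`. -/
def errorFilter {Ω ι E : Type*} [TopologicalSpace E] (e : ι → ℕ → Ω → ℝ) (Y : Ω → E) (y : E) :
    Filter (ℕ × Ω) :=
  comap Prod.fst atTop ⊓ comap (fun q => Y q.2) (𝓝 y) ⊓ ⨅ i, comap (fun q => e i q.1 q.2) (𝓝 0)

section errorFilter

variable {Ω ι E : Type*} [TopologicalSpace E] (e : ι → ℕ → Ω → ℝ) (Y : Ω → E) (y : E)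

theorem tendsto_fst_errorFilter : Tendsto Prod.fst (errorFilter e Y y) atTop :=
  tendsto_comap.mono_left (inf_le_left.trans inf_le_left)

theorem tendsto_param_errorFilter : Tendsto (fun q : ℕ × Ω => Y q.2) (errorFilter e Y y) (𝓝 y) :=
  tendsto_comap.mono_left (inf_le_left.trans inf_le_right)

theorem tendsto_error_errorFilter (i : ι) :
    Tendsto (fun q : ℕ × Ω => e i q.1 q.2) (errorFilter e Y y) (𝓝 0) :=
  tendsto_comap.mono_left (inf_le_right.trans (iInf_le _ i))

/-- Finiteness of `ι` allows one `δ`, the minimum of the individual thresholds, to serve for all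
errors. -/
theorem exists_of_eventually_errorFilter [Finite ι] {B : ℕ → Set Ω}
    (h : ∀ᶠ q in errorFilter e Y y, q.2 ∉ B q.1) :
    ∃ V ∈ 𝓝 y, ∃ N : ℕ, ∃ δ > 0, ∀ p ≥ N, ∀ ω, Y ω ∈ V → (∀ i, |e i p ω| < δ) → ω ∉ B p := by
  unfold errorFilter at h
  obtain ⟨s, hs, t, ht, hst⟩ := eventually_inf.1 h
  obtain ⟨s₁, hs₁, s₂, hs₂, hs₁₂⟩ := mem_inf_iff_superset.1 hs
  obtain ⟨T, hT, hTs⟩ := mem_comap.1 hs₁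
  obtain ⟨V, hV, hVs⟩ := mem_comap.1 hs₂
  obtain ⟨N, hN⟩ := mem_atTop_sets.1 hT
  have hδ : ∃ δ > 0, ∀ q : ℕ × Ω, (∀ i, |e i q.1 q.2| < δ) → q ∈ t := by
    obtain ⟨W, hW, rfl⟩ := (mem_iInf_of_finite _).1 ht
    have h1 : ∀ i, ∃ δ > 0, ∀ q : ℕ × Ω, |e i q.1 q.2| < δ → q ∈ W i := by
      intro i
      obtain ⟨A, hA, hAW⟩ := mem_comap.1 (hW i)
      obtain ⟨δ, hδ, hb⟩ := Metric.mem_nhds_iff.1 hA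
      exact ⟨δ, hδ, fun q hq => hAW (hb (by simpa [Real.dist_eq] using hq))⟩
    choose δ hδ hW' using h1
    cases nonempty_fintype ι
    obtain ⟨d, hd, hdi⟩ : ∃ d > 0, ∀ i, d ≤ δ i := by
      rcases isEmpty_or_nonempty ι with hι | hι
      · exact ⟨1, one_pos, fun i => (hι.false i).elim⟩
      · obtain ⟨i₀, hi₀⟩ := Finite.exists_min δ
        exact ⟨δ i₀, hδ i₀, hi₀⟩
    exact ⟨d, hd, fun q hq => Set.mem_iInter.2 fun i => hW' i q ((hq i).trans_le (hdi i))⟩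
  obtain ⟨δ, hδ, ht'⟩ := hδ
  exact ⟨V, hV, N, δ, hδ, fun p hp ω hω he =>
    hst (p, ω) ⟨hs₁₂ ⟨hTs (hN p hp), hVs hω⟩, ht' (p, ω) he⟩⟩

end errorFilter

/-- An event that eventually fails along every `errorFilter` has measure tending to zero. -/
theorem tendsto_measure_zero_of_errorFilter {Ω ι E : Type*} [MeasurableSpace Ω] {P : Measure Ω}
    [IsFiniteMeasure P] [Finite ι] [TopologicalSpace E] [PolishSpace E] [MeasurableSpace E]
    [BorelSpace E] {e : ι → ℕ → Ω → ℝ} (he : ∀ i, TendstoInMeasure P (e i) atTop 0)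
    {Y : Ω → E} (hY : Measurable Y) {U : Set E} (hU : IsOpen U) (hYU : ∀ᵐ ω ∂P, Y ω ∈ U)
    {B : ℕ → Set Ω} (hB : ∀ y ∈ U, ∀ᶠ q in errorFilter e Y y, q.2 ∉ B q.1) :
    Tendsto (fun p => P (B p)) atTop (𝓝 0) := by
  let _ := TopologicalSpace.upgradeIsCompletelyMetrizable E
  cases nonempty_fintype ι
  rw [ENNReal.tendsto_nhds_zero]
  intro ε hε
  -- The law of `Y` on a Polish space is inner regular by compact sets, so all but `ε / 2` of its
  -- mass on `U` sits on a compact `K`.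
  obtain ⟨K, hKU, hK, hKε⟩ := hU.measurableSet.exists_isCompact_sdiff_lt (μ := P.map Y)
    (measure_ne_top _ _) (ENNReal.half_pos hε.ne').ne'
  have hunif : ∃ N : ℕ, ∃ δ > 0, ∀ p ≥ N, ∀ ω, Y ω ∈ K → (∀ i, |e i p ω| < δ) → ω ∉ B p := by
    -- Having thresholds `N`, `δ` that are uniform over a set passes to subsets and finite unions
    -- and holds near each point of `U`, hence holds on `K`.
    refine hK.induction_on (p := fun K => ∃ N : ℕ, ∃ δ > 0, ∀ p ≥ N, ∀ ω, Y ω ∈ K →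
      (∀ i, |e i p ω| < δ) → ω ∉ B p) ⟨0, 1, one_pos, by simp⟩ ?_ ?_ ?_
    · rintro s t hst ⟨N, δ, hδ, h⟩
      exact ⟨N, δ, hδ, fun p hp ω hω => h p hp ω (hst hω)⟩
    · rintro s t ⟨N, δ, hδ, h⟩ ⟨N', δ', hδ', h'⟩
      refine ⟨max N N', min δ δ', lt_min hδ hδ', fun p hp ω hω hlt => ?_⟩
      rcases hω with hω | hω
      · exact h p (le_of_max_le_left hp) ω hω fun i => (hlt i).trans_le (min_le_left _ _)
      · exact h' p (le_of_max_le_right hp) ω hω fun i => (hlt i).trans_le (min_le_right _ _)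
    · intro y hy
      obtain ⟨V, hV, h⟩ := exists_of_eventually_errorFilter e Y y (hB y (hKU hy))
      exact ⟨V, mem_nhdsWithin_of_mem_nhds hV, h⟩
  obtain ⟨N, δ, hδ, h⟩ := hunif
  have hsum : Tendsto (fun p => ∑ i, P {ω | δ ≤ |e i p ω|}) atTop (𝓝 0) := by
    rw [← Finset.sum_const_zero (s := (Finset.univ : Finset ι))]
    refine tendsto_finsetSum _ fun i _ => ?_
    simpa [Real.norm_eq_abs] using tendstoInMeasure_iff_norm.1 (he i) δ hδ
  have hUc : P {ω | Y ω ∉ U} = 0 := hYU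
  have hdiff : P {ω | Y ω ∈ U \ K} ≤ ε / 2 := by
    rw [Measure.map_apply hY (hU.measurableSet.diff hK.measurableSet)] at hKε
    exact hKε.le
  filter_upwards [(ENNReal.tendsto_nhds_zero.1 hsum) _ (ENNReal.half_pos hε.ne'),
    eventually_ge_atTop N] with p hp hpN
  -- Monotonicity and subadditivity hold for outer measures, so `B p` may be non-measurable.
  have hsub : B p ⊆ {ω | Y ω ∉ U} ∪ ({ω | Y ω ∈ U \ K} ∪ ⋃ i, {ω | δ ≤ |e i p ω|}) := by
    intro ω hω
    by_contra hcon
    simp only [Set.mem_union, Set.mem_ofPred_eq, Set.mem_sdiff, Set.mem_iUnion, not_or, not_and,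
      not_not, not_exists, not_le] at hcon
    exact h p hpN ω (hcon.2.1 hcon.1) hcon.2.2 hω
  calc P (B p) ≤ P {ω | Y ω ∉ U} + (P {ω | Y ω ∈ U \ K} + P (⋃ i, {ω | δ ≤ |e i p ω|})) :=
        (measure_mono hsub).trans ((measure_union_le _ _).trans
          (add_le_add_right (measure_union_le _ _) _))
    _ ≤ 0 + (ε / 2 + ε / 2) := by
        gcongr
        · exact hUc.le
        · exact (measure_iUnion_fintype_le _ _).trans hp
    _ = ε := by rw [zero_add, ENNReal.add_halves]

/-- Convergence along every `errorFilter` to a function of the parameter that is continuous on `U`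
implies convergence in measure. -/
theorem tendstoInMeasure_of_errorFilter {Ω ι E : Type*} [MeasurableSpace Ω] {P : Measure Ω}
    [IsFiniteMeasure P] [Finite ι] [TopologicalSpace E] [PolishSpace E] [MeasurableSpace E]
    [BorelSpace E] {e : ι → ℕ → Ω → ℝ} (he : ∀ i, TendstoInMeasure P (e i) atTop 0)
    {Y : Ω → E} (hY : Measurable Y) {U : Set E} (hU : IsOpen U) (hYU : ∀ᵐ ω ∂P, Y ω ∈ U)
    {f : ℕ → Ω → ℝ} {F : E → ℝ} (hF : ContinuousOn F U)
    (hf : ∀ y ∈ U, Tendsto (fun q : ℕ × Ω => f q.1 q.2) (errorFilter e Y y) (𝓝 (F y))) :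
    TendstoInMeasure P f atTop (fun ω => F (Y ω)) := by
  rw [tendstoInMeasure_iff_norm]
  intro ε hε
  refine tendsto_measure_zero_of_errorFilter he hY hU hYU fun y hy => ?_
  have h := (hf y hy).sub (((hF.continuousAt (hU.mem_nhds hy)).tendsto).comp
    (tendsto_param_errorFilter e Y y))
  rw [sub_self] at h
  filter_upwards [h.norm.eventually_lt_const (by simpa using hε)] with q hq
  simpa using hq

/-! ### Asymptotics of the leading eigenpair of a Gram matrix -/

section Leading

variable {ι : Type*} {l : Filter ι} {n : ℕ}

/-- Since `|y| ≤ y² + 1`, a convergent bound on `y²` controls `y`. This is how the eigenvector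
coordinates enter: bounded, with no limit of their own. -/
theorem tendsto_mul_zero_of_sq_le {y e m : ι → ℝ} {M : ℝ} (hy : ∀ᶠ q in l, y q ^ 2 ≤ m q)
    (hm : Tendsto m l (𝓝 M)) (he : Tendsto e l (𝓝 0)) :
    Tendsto (fun q => y q * e q) l (𝓝 0) := by
  have h1 : Tendsto (fun q => (m q + 1) * |e q|) l (𝓝 0) := by
    simpa using (hm.add_const 1).mul he.abs
  refine squeeze_zero_norm' ?_ h1
  filter_upwards [hy] with q hq
  rw [Real.norm_eq_abs, abs_mul]
  refine mul_le_mul_of_nonneg_right ?_ (abs_nonneg _)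
  nlinarith [sq_abs (y q), sq_nonneg (|y q| - 1), abs_nonneg (y q)]

/-- The quadratic form of `α ζ ζᵀ + τ (I - J)` on centered vectors. -/
theorem quadForm_spiked {α τ : ℝ} {ζ y : Fin n → ℝ} (hy : ∑ i, y i = 0) :
    ∑ i, ∑ j, y i * y j * (α * ζ i * ζ j + τ * ((if i = j then 1 else 0) - (n : ℝ)⁻¹)) =
      α * (∑ i, y i * ζ i) ^ 2 + τ * ∑ i, y i ^ 2 := by
  have h1 : ∀ i j, y i * y j * (α * ζ i * ζ j + τ * ((if i = j then 1 else 0) - (n : ℝ)⁻¹)) =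
      α * ((y i * ζ i) * (y j * ζ j)) + τ * (if i = j then y i * y j else 0)
        - τ * (n : ℝ)⁻¹ * (y i * y j) := by
    intro i j; split_ifs <;> ring
  simp only [h1, Finset.sum_add_distrib, Finset.sum_sub_distrib, ← Finset.mul_sum,
    Finset.sum_ite_eq, Finset.mem_univ, if_true, ← Finset.sum_mul, hy, sq]
  ring

/-- A centered `ζ` is fixed by `I - J`, so it is an exact eigenvector of the limiting Gram matrix
and the natural test vector for the lower bound on the top eigenvalue. -/
theorem mulVec_spiked {α τ : ℝ} {ζ : Fin n → ℝ} (hζ : ∑ i, ζ i = 0) (j : Fin n) :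
    ∑ i, ζ i * (α * ζ j * ζ i + τ * ((if j = i then 1 else 0) - (n : ℝ)⁻¹)) =
      (α * (∑ i, ζ i ^ 2) + τ) * ζ j := by
  have h1 : ∀ i, ζ i * (α * ζ j * ζ i + τ * ((if j = i then 1 else 0) - (n : ℝ)⁻¹)) =
      α * ζ j * ζ i ^ 2 + τ * (if j = i then ζ i else 0) - τ * (n : ℝ)⁻¹ * ζ i := by
    intro i; split_ifs <;> ring
  simp only [h1, Finset.sum_add_distrib, Finset.sum_sub_distrib, ← Finset.mul_sum,
    Finset.sum_ite_eq, Finset.mem_univ, if_true, hζ]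
  ring

variable {α τ : ℝ} {ζ : Fin n → ℝ} {D : ι → Fin n → Fin n → ℝ} {y : ι → Fin n → ℝ} {L : ι → ℝ}

/-- Each `|y i * y j|` is at most `L`. The limiting matrix can thus replace the actual one at a
moving vector. -/
theorem abs_quadForm_sub_le {A A' : Fin n → Fin n → ℝ} {y : Fin n → ℝ} {L : ℝ}
    (hy : ∑ j, y j ^ 2 = L) :
    |∑ i, ∑ j, y i * y j * A i j - ∑ i, ∑ j, y i * y j * A' i j| ≤
      L * ∑ i, ∑ j, |A i j - A' i j| := by
  have hle : ∀ i, y i ^ 2 ≤ L := fun i =>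
    hy ▸ Finset.single_le_sum (f := fun j => y j ^ 2) (fun j _ => sq_nonneg _) (Finset.mem_univ i)
  rw [← Finset.sum_sub_distrib, Finset.mul_sum]
  refine (Finset.abs_sum_le_sum_abs _ _).trans (Finset.sum_le_sum fun i _ => ?_)
  rw [← Finset.sum_sub_distrib, Finset.mul_sum]
  refine (Finset.abs_sum_le_sum_abs _ _).trans (Finset.sum_le_sum fun j _ => ?_)
  rw [← mul_sub, abs_mul]
  refine mul_le_mul_of_nonneg_right ?_ (abs_nonneg _)
  rw [abs_le]
  constructor <;> nlinarith [hle i, hle j, sq_nonneg (y i + y j), sq_nonneg (y i - y j)]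

/-- The leading eigenvalue of a Gram matrix converging to `α ζ ζᵀ + τ (I - J)`. -/
theorem tendsto_leading_eigenvalue (hα : 0 ≤ α) (hτ : 0 < τ) (hζ : ∑ i, ζ i = 0)
    (hs : 0 < α * ∑ i, ζ i ^ 2)
    (hD : ∀ i j, Tendsto (fun q => D q i j) l
      (𝓝 (α * ζ i * ζ j + τ * ((if i = j then 1 else 0) - (n : ℝ)⁻¹))))
    (hy : ∀ᶠ q in l, ∑ j, y q j ^ 2 = L q) (hy0 : ∀ᶠ q in l, ∑ j, y q j = 0)
    (heig : ∀ᶠ q in l, ∑ i, ∑ j, y q i * y q j * D q i j = L q ^ 2)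
    (hmax : ∀ᶠ q in l, ∑ j, (∑ i, ζ i * D q j i) ^ 2 ≤
      L q * ∑ i, ∑ j, ζ i * ζ j * D q i j) :
    Tendsto L l (𝓝 (α * (∑ i, ζ i ^ 2) + τ)) := by
  set s := α * ∑ i, ζ i ^ 2 with hsdef
  set R := ∑ i, ζ i ^ 2 with hR
  have hRpos : 0 < R := by
    rcases hα.eq_or_lt with h | h
    · simp [hsdef, ← h] at hs
    · exact (mul_pos_iff_of_pos_left h).1 hs
  have hquad : Tendsto (fun q => ∑ i, ∑ j, ζ i * ζ j * D q i j) l (𝓝 ((s + τ) * R)) := by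
    have := tendsto_finsetSum Finset.univ fun i _ => tendsto_finsetSum Finset.univ fun j _ =>
      (hD i j).const_mul (ζ i * ζ j)
    rw [quadForm_spiked hζ] at this
    convert this using 2
    simp only [← sq, hsdef, hR]; ring
  have hnorm : Tendsto (fun q => ∑ j, (∑ i, ζ i * D q j i) ^ 2) l (𝓝 ((s + τ) ^ 2 * R)) := by
    have := tendsto_finsetSum Finset.univ fun j _ => (tendsto_finsetSum Finset.univ fun i _ =>
      (hD j i).const_mul (ζ i)).pow 2
    simp only [mulVec_spiked hζ, mul_pow, ← Finset.mul_sum] at this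
    exact this
  have hpos : 0 < (s + τ) * R := by positivity
  -- `hmax` is the inequality `D² ≤ L D`, valid for the top eigenvalue, tested at `ζ`; the resulting
  -- lower bound for `L` is asymptotically sharp.
  have hlow : Tendsto (fun q => (∑ j, (∑ i, ζ i * D q j i) ^ 2) /
      ∑ i, ∑ j, ζ i * ζ j * D q i j) l (𝓝 (s + τ)) := by
    have h := hnorm.div hquad hpos.ne'
    rwa [show (s + τ) ^ 2 * R / ((s + τ) * R) = s + τ by field_simp] at h
  have hE : Tendsto (fun q => ∑ i, ∑ j, |D q i j -
      (α * ζ i * ζ j + τ * ((if i = j then 1 else 0) - (n : ℝ)⁻¹))|) l (𝓝 0) := by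
    have := tendsto_finsetSum Finset.univ fun i _ => tendsto_finsetSum Finset.univ fun j _ =>
      ((hD i j).sub_const (α * ζ i * ζ j + τ * ((if i = j then 1 else 0) - (n : ℝ)⁻¹))).abs
    simpa using this
  have hup := hE.const_add (s + τ)
  rw [add_zero] at hup
  have hlow' : ∀ᶠ q in l, (∑ j, (∑ i, ζ i * D q j i) ^ 2) /
      (∑ i, ∑ j, ζ i * ζ j * D q i j) ≤ L q := by
    filter_upwards [hmax, hquad.eventually_const_lt hpos] with q h1 h2
    rwa [div_le_iff₀ h2]
  refine tendsto_of_tendsto_of_tendsto_of_le_of_le' hlow hup hlow' ?_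
  filter_upwards [hlow', hlow.eventually_const_lt (show 0 < s + τ by positivity), hy, hy0, heig]
    with q h1 h2 h3 h4 h5
  have hL : 0 < L q := h2.trans_le h1
  have h6 := (abs_le.1 (abs_quadForm_sub_le (A := D q) (A' := fun i j => α * ζ i * ζ j +
    τ * ((if i = j then 1 else 0) - (n : ℝ)⁻¹)) h3)).2
  rw [h5, quadForm_spiked h4, h3] at h6
  -- Cauchy–Schwarz gives `L² ≤ L (s + τ + EE)`, with `EE` the total entrywise error; then `L > 0`
  -- is cancelled.
  have h7 : (∑ i, y q i * ζ i) ^ 2 ≤ L q * R := by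
    rw [← h3]; exact Finset.sum_mul_sq_le_sq_mul_sq _ _ _
  have h8 := mul_le_mul_of_nonneg_left h7 hα
  set EE := ∑ i, ∑ j, |D q i j - (α * ζ i * ζ j + τ * ((if i = j then 1 else 0) - (n : ℝ)⁻¹))|
  have h9 : L q * L q ≤ L q * (s + τ + EE) := by
    rw [hsdef]; nlinarith
  exact le_of_mul_le_mul_left h9 hL

/-- The squared inner product of the (scaled) leading eigenvector with the spike. -/
theorem tendsto_sq_inner_spike
    (hD : ∀ i j, Tendsto (fun q => D q i j) l
      (𝓝 (α * ζ i * ζ j + τ * ((if i = j then 1 else 0) - (n : ℝ)⁻¹))))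
    (hy : ∀ᶠ q in l, ∑ j, y q j ^ 2 = L q) (hy0 : ∀ᶠ q in l, ∑ j, y q j = 0)
    (heig : ∀ᶠ q in l, ∑ i, ∑ j, y q i * y q j * D q i j = L q ^ 2)
    {s : ℝ} (hL : Tendsto L l (𝓝 (s + τ))) :
    Tendsto (fun q => α * (∑ i, y q i * ζ i) ^ 2) l (𝓝 ((s + τ) * s)) := by
  have hE : Tendsto (fun q => ∑ i, ∑ j, |D q i j -
      (α * ζ i * ζ j + τ * ((if i = j then 1 else 0) - (n : ℝ)⁻¹))|) l (𝓝 0) := by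
    have := tendsto_finsetSum Finset.univ fun i _ => tendsto_finsetSum Finset.univ fun j _ =>
      ((hD i j).sub_const (α * ζ i * ζ j + τ * ((if i = j then 1 else 0) - (n : ℝ)⁻¹))).abs
    simpa using this
  have h1 : Tendsto (fun q => L q ^ 2 - τ * L q) l (𝓝 ((s + τ) * s)) := by
    have := (hL.pow 2).sub (hL.const_mul τ)
    convert this using 2; ring
  -- On centered `y`, the limiting form is `α (y · ζ)² + τ L`, while the actual form equals `L²`.
  have h2 : Tendsto (fun q => L q ^ 2 - τ * L q - α * (∑ i, y q i * ζ i) ^ 2) l (𝓝 0) := by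
    have h0 := hL.mul hE
    rw [mul_zero] at h0
    refine squeeze_zero_norm' ?_ h0
    filter_upwards [hy, hy0, heig] with q h3 h4 h5
    have h6 := abs_quadForm_sub_le (A := D q) (A' := fun i j => α * ζ i * ζ j +
      τ * ((if i = j then 1 else 0) - (n : ℝ)⁻¹)) h3
    rw [h5, quadForm_spiked h4, h3] at h6
    rw [Real.norm_eq_abs]
    convert h6 using 2; ring
  simpa using h1.sub h2

/-- Cosines of the leading principal component direction with two directions whose scores are
asymptotically proportional to the spike. -/
theorem tendsto_cosines {σ a s : ℝ} (hs : 0 < s) (hτ : 0 < τ)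
    (hy : ∀ᶠ q in l, ∑ j, y q j ^ 2 = L q)
    (hL : Tendsto L l (𝓝 (s + τ)))
    (hq : Tendsto (fun q => (σ * ∑ i, y q i * ζ i) ^ 2) l (𝓝 ((s + τ) * s)))
    {g h : ι → Fin n → ℝ} {b c : ι → ℝ} (hg : ∀ j, Tendsto (fun q => g q j) l (𝓝 (σ * ζ j)))
    (hh : ∀ j, Tendsto (fun q => h q j) l (𝓝 (a * (σ * ζ j))))
    (hb : ∀ᶠ q in l, 0 ≤ b q) (hgb : ∀ᶠ q in l, ∑ j, y q j * g q j = L q * b q)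
    (hhc : ∀ᶠ q in l, ∑ j, y q j * h q j = L q * c q) :
    Tendsto b l (𝓝 √(s / (s + τ))) ∧ Tendsto c l (𝓝 (a * √(s / (s + τ)))) := by
  have hst : 0 < s + τ := by positivity
  have hyj : ∀ j, ∀ᶠ q in l, y q j ^ 2 ≤ L q := fun j => by
    filter_upwards [hy] with q hq
    rw [← hq]
    exact Finset.single_le_sum (f := fun j => y q j ^ 2) (fun j _ => sq_nonneg _)
      (Finset.mem_univ j)
  have hsmall : ∀ {k : ι → Fin n → ℝ}, (∀ j, Tendsto (fun q => k q j) l (𝓝 0)) →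
      Tendsto (fun q => ∑ j, y q j * k q j) l (𝓝 0) := fun {k} hk => by
    simpa using tendsto_finsetSum Finset.univ fun j _ =>
      tendsto_mul_zero_of_sq_le (hyj j) hL (hk j)
  have hg0 : Tendsto (fun q => ∑ j, y q j * (g q j - σ * ζ j)) l (𝓝 0) :=
    hsmall fun j => by simpa using (hg j).sub_const (σ * ζ j)
  have hgh0 : Tendsto (fun q => ∑ j, y q j * (h q j - a * g q j)) l (𝓝 0) :=
    hsmall fun j => by simpa using (hh j).sub ((hg j).const_mul a)
  have hLpos := hL.eventually_const_lt hst
  -- Here `L b = σ (y · ζ) + o(1)`. Only the square of `σ (y · ζ)` is known to converge, so the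
  -- identity is squared; `b ≥ 0` recovers the root afterwards.
  have hb2 : Tendsto (fun q => b q ^ 2) l (𝓝 (s / (s + τ))) := by
    have h1 : Tendsto (fun q => ((σ * ∑ i, y q i * ζ i) ^ 2 +
        2 * ((σ * ∑ i, y q i * ζ i) * ∑ j, y q j * (g q j - σ * ζ j)) +
        (∑ j, y q j * (g q j - σ * ζ j)) ^ 2) / L q ^ 2) l (𝓝 (s / (s + τ))) := by
      have h2 := tendsto_mul_zero_of_sq_le (Eventually.of_forall fun q => le_rfl) hq hg0
      have h3 := ((hq.add (h2.const_mul 2)).add (hg0.pow 2)).div (hL.pow 2) (by positivity)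
      rwa [show ((s + τ) * s + 2 * 0 + 0 ^ 2) / (s + τ) ^ 2 = s / (s + τ) by
        field_simp; ring] at h3
    refine h1.congr' ?_
    filter_upwards [hgb, hLpos] with q h4 h5
    have h6 : ∑ j, y q j * (g q j - σ * ζ j) = L q * b q - σ * ∑ i, y q i * ζ i := by
      rw [← h4, Finset.mul_sum, ← Finset.sum_sub_distrib]
      exact Finset.sum_congr rfl fun j _ => by ring
    rw [h6]
    field_simp
    ring
  have hb1 : Tendsto b l (𝓝 √(s / (s + τ))) := by
    refine (hb2.sqrt).congr' ?_
    filter_upwards [hb] with q hq using Real.sqrt_sq hq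
  refine ⟨hb1, ?_⟩
  -- Comparing `h` with `a g`, rather than with its limit, ties the sign of `c` to that of `b`.
  have h7 : Tendsto (fun q => a * b q + (∑ j, y q j * (h q j - a * g q j)) / L q) l
      (𝓝 (a * √(s / (s + τ)))) := by
    simpa using (hb1.const_mul a).add (hgh0.div hL hst.ne')
  refine h7.congr' ?_
  filter_upwards [hgb, hhc, hLpos] with q h8 h9 h10
  have h11 : ∑ j, y q j * (h q j - a * g q j) = L q * c q - a * (L q * b q) := by
    rw [← h8, ← h9, Finset.mul_sum, ← Finset.sum_sub_distrib]
    exact Finset.sum_congr rfl fun j _ => by ring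
  rw [h11]
  field_simp
  ring

end Leading

/-! ### The sample covariance matrix -/

section Sample

variable {n p : ℕ}

/-- Subtraction of the average. -/
def center (f : Fin n → ℝ) (i : Fin n) : ℝ := f i - (n : ℝ)⁻¹ * ∑ j, f j

theorem sum_center (hn : n ≠ 0) (f : Fin n → ℝ) : ∑ i, center f i = 0 := by
  have : (n : ℝ) ≠ 0 := Nat.cast_ne_zero.2 hn
  simp only [center, Finset.sum_sub_distrib, Finset.sum_const, Finset.card_univ, Fintype.card_fin,
    nsmul_eq_mul]
  field_simp
  ring

theorem tendsto_center {ι : Type*} {l : Filter ι} {f : ι → Fin n → ℝ} {g : Fin n → ℝ}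
    (h : ∀ i, Tendsto (fun q => f q i) l (𝓝 (g i))) (i : Fin n) :
    Tendsto (fun q => center (f q) i) l (𝓝 (center g i)) :=
  (h i).sub ((tendsto_finsetSum Finset.univ fun j _ => h j).const_mul _)

theorem center_const_mul (c : ℝ) (f : Fin n → ℝ) (i : Fin n) :
    center (fun j => c * f j) i = c * center f i := by
  simp only [center, ← Finset.mul_sum]; ring

theorem center_div (c : ℝ) (f : Fin n → ℝ) (i : Fin n) :
    center (fun j => f j / c) i = center f i / c := by
  simp only [center, ← Finset.sum_div]; ring

/-- Centering removes any fixed shift `m`, so the true mean, relative to which the scores are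
defined, can be inserted. -/
theorem inner_sub_sampleMean (x : Fin n → Vec p) (m a : Vec p) (hn : n ≠ 0) (i : Fin n) :
    ⟪x i - sampleMean x, a⟫ = center (fun j => ⟪x j - m, a⟫) i := by
  have : (n : ℝ) ≠ 0 := Nat.cast_ne_zero.2 hn
  simp only [center, sampleMean, inner_sub_left, real_inner_smul_left, sum_inner,
    Finset.sum_sub_distrib, Finset.sum_const, Finset.card_univ, Fintype.card_fin, nsmul_eq_mul]
  field_simp
  ring

theorem inner_sub_sampleMean_sub_sampleMean (x : Fin n → Vec p) (m : Vec p) (hn : n ≠ 0)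
    (i j : Fin n) :
    ⟪x i - sampleMean x, x j - sampleMean x⟫ =
      center (fun k => center (fun k' => ⟪x k - m, x k' - m⟫) j) i := by
  rw [inner_sub_sampleMean x m _ hn i]
  congr 1
  funext k
  rw [real_inner_comm, inner_sub_sampleMean x m _ hn j]
  simp only [real_inner_comm (x k - m)]

theorem toLp_vecMulVec_mulVec (x y a : Vec p) :
    WithLp.toLp 2 ((Matrix.vecMulVec (x : Fin p → ℝ) y).mulVec a) = ⟪y, a⟫ • x := by
  ext i
  simp [Matrix.vecMulVec_mulVec, EuclideanSpace.inner_eq_star_dotProduct, dotProduct_comm,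
    mul_comm (x i)]

theorem toLp_sampleCov_mulVec (x : Fin n → Vec p) (a : Vec p) :
    WithLp.toLp 2 ((sampleCov x).mulVec a) =
      (n : ℝ)⁻¹ • ∑ i, ⟪x i - sampleMean x, a⟫ • (x i - sampleMean x) := by
  simp only [sampleCov, Matrix.smul_mulVec, Matrix.sum_mulVec, WithLp.toLp_smul, WithLp.toLp_sum]
  congr 1
  exact Finset.sum_congr rfl fun i _ => toLp_vecMulVec_mulVec _ _ _

variable {x : Fin n → Vec p} {u : ℕ → Vec p} {lamHat : ℕ → ℝ} {uHat : ℕ → Vec p}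

namespace IsSamplePCA

variable (h : IsSamplePCA x u lamHat uHat)

include h

/-- Both sides are `n S a`, computed from the definition of `S` and from its eigendecomposition. -/
theorem sum_inner_smul (hn : n ≠ 0) (a : Vec p) :
    ∑ i, ⟪x i - sampleMean x, a⟫ • (x i - sampleMean x) =
      (n : ℝ) • ∑ k ∈ Finset.range (n - 1), lamHat k • ⟪uHat k, a⟫ • uHat k := by
  have h0 : (n : ℝ) ≠ 0 := Nat.cast_ne_zero.2 hn
  have h1 := toLp_sampleCov_mulVec x a
  rw [h.eq_sum] at h1
  simp only [Matrix.sum_mulVec, Matrix.smul_mulVec, WithLp.toLp_smul, WithLp.toLp_sum,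
    toLp_vecMulVec_mulVec] at h1
  rw [h1, smul_smul, mul_inv_cancel₀ h0, one_smul]

theorem inner_uHat {k m : ℕ} (hk : k < n - 1) (hm : m < n - 1) :
    ⟪uHat k, uHat m⟫ = if k = m then 1 else 0 := by
  have := orthonormal_iff_ite.1 h.orthonormal ⟨k, hk⟩ ⟨m, hm⟩
  simpa [Fin.ext_iff] using this

theorem norm_uHat {k : ℕ} (hk : k < n - 1) : ‖uHat k‖ = 1 :=
  h.orthonormal.1 ⟨k, hk⟩

theorem sum_inner_mul_inner (hn : n ≠ 0) (a b : Vec p) :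
    ∑ i, ⟪x i - sampleMean x, a⟫ * ⟪x i - sampleMean x, b⟫ =
      n * ∑ k ∈ Finset.range (n - 1), lamHat k * (⟪uHat k, a⟫ * ⟪uHat k, b⟫) := by
  have := congrArg (fun w => ⟪w, b⟫) (h.sum_inner_smul hn a)
  simpa only [sum_inner, real_inner_smul_left] using this

/-- The eigenvector equation for `uHat m`. -/
theorem sum_inner_uHat_mul_inner (hn : n ≠ 0) {m : ℕ} (hm : m < n - 1) (a : Vec p) :
    ∑ i, ⟪x i - sampleMean x, uHat m⟫ * ⟪x i - sampleMean x, a⟫ =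
      n * lamHat m * ⟪uHat m, a⟫ := by
  rw [h.sum_inner_mul_inner hn, mul_assoc]
  congr 1
  rw [Finset.sum_eq_single_of_mem m (Finset.mem_range.2 hm)]
  · rw [h.inner_uHat hm hm, if_pos rfl, one_mul]
  · intro k hk hkm
    rw [h.inner_uHat (Finset.mem_range.1 hk) hm, if_neg hkm]; ring

theorem sum_inner_uHat_sq (hn : n ≠ 0) {m : ℕ} (hm : m < n - 1) :
    ∑ i, ⟪x i - sampleMean x, uHat m⟫ ^ 2 = n * lamHat m := by
  simpa [sq, real_inner_self_eq_norm_sq, h.norm_uHat hm] using h.sum_inner_uHat_mul_inner hn hm (uHat m)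

theorem lamHat_nonneg (hn : n ≠ 0) {m : ℕ} (hm : m < n - 1) : 0 ≤ lamHat m := by
  have h1 : 0 ≤ (n : ℝ) * lamHat m :=
    h.sum_inner_uHat_sq hn hm ▸ Finset.sum_nonneg fun i _ => sq_nonneg _
  exact nonneg_of_mul_nonneg_right h1 (by positivity)

/-- The leading eigenvalue dominates the quadratic form of the sample covariance. -/
theorem sum_inner_sq_le (hn : 1 < n) (a : Vec p) :
    ∑ i, ⟪x i - sampleMean x, a⟫ ^ 2 ≤ n * lamHat 0 * ‖a‖ ^ 2 := by
  have hn0 : n ≠ 0 := by omega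
  have h0 : 0 < n - 1 := by omega
  have h1 := h.sum_inner_mul_inner hn0 a a
  simp only [← sq] at h1
  rw [h1, mul_assoc]
  refine mul_le_mul_of_nonneg_left ?_ (Nat.cast_nonneg n)
  calc ∑ k ∈ Finset.range (n - 1), lamHat k * ⟪uHat k, a⟫ ^ 2
      ≤ ∑ k ∈ Finset.range (n - 1), lamHat 0 * ⟪uHat k, a⟫ ^ 2 :=
        Finset.sum_le_sum fun k hk => mul_le_mul_of_nonneg_right
          (h.antitone 0 k (Nat.zero_le _) (Finset.mem_range.1 hk)) (sq_nonneg _)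
    _ = lamHat 0 * ∑ k : Fin (n - 1), ‖⟪uHat k, a⟫‖ ^ 2 := by
        rw [← Finset.mul_sum, Finset.sum_range]; simp
    _ ≤ lamHat 0 * ‖a‖ ^ 2 := mul_le_mul_of_nonneg_left
        (h.orthonormal.sum_inner_products_le a) (h.lamHat_nonneg hn0 h0)

/-- The trace of `n S`, obtained by testing the quadratic form on the coordinate vectors. -/
theorem sum_norm_sq (hn : n ≠ 0) :
    ∑ i, ⟪x i - sampleMean x, x i - sampleMean x⟫ =
      n * ∑ k ∈ Finset.range (n - 1), lamHat k := by
  have h1 : ∑ i, ⟪x i - sampleMean x, x i - sampleMean x⟫ =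
      ∑ a : Fin p, ∑ i, ⟪x i - sampleMean x, EuclideanSpace.single a 1⟫ ^ 2 := by
    rw [Finset.sum_comm]
    refine Finset.sum_congr rfl fun i _ => ?_
    simp [EuclideanSpace.norm_sq_eq, EuclideanSpace.inner_single_right]
  have h2 : ∀ k ∈ Finset.range (n - 1),
      ∑ a : Fin p, ⟪uHat k, EuclideanSpace.single a 1⟫ ^ 2 = 1 := by
    intro k hk
    have h3 := EuclideanSpace.norm_sq_eq (uHat k)
    rw [h.norm_uHat (Finset.mem_range.1 hk)] at h3
    simpa [EuclideanSpace.inner_single_right] using h3.symm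
  rw [h1]
  simp only [sq, h.sum_inner_mul_inner hn]
  rw [← Finset.mul_sum, Finset.sum_comm]
  congr 1
  refine Finset.sum_congr rfl fun k hk => ?_
  rw [← Finset.mul_sum]
  simp only [← sq, h2 k hk, mul_one]

end IsSamplePCA

end Sample

/-! ### The ARG direction -/

section ARGDirection

variable {n p : ℕ} {lamHat : ℕ → ℝ} {uHat : ℕ → Vec p} {v u₁ w : Vec p}

/-- The cosine between the true and the ARG direction, in terms of `κ = lam / (lamHat 0 - lam)`, of
the cosines `b`, `c` of `uHat 0` with `u₁`, `v`, and of the cosine `a` of `v` with `u₁`. -/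
def argCos (κ a b c : ℝ) : ℝ :=
  |b + κ * c * (a - c * b) / (1 - c ^ 2)| / √(1 + κ ^ 2 * c ^ 2 / (1 - c ^ 2))

/-- With `r` the ridge parameter, `S₁ - r I` acts as `lamHat 0 - r` on `uHat 0` and as `-r` on its
complement. Hence `-r (S₁ - r I)⁻¹` fixes the complement and scales `uHat 0` by `-r / (lamHat 0 -
r)`. -/
theorem ridgedDiscriminant_eq (hu : ‖uHat 0‖ = 1) (hr : ridgeParam n lamHat ≠ 0)
    (hl : lamHat 0 ≠ ridgeParam n lamHat) :
    ridgedDiscriminant n lamHat uHat v = v - ⟪uHat 0, v⟫ • uHat 0 -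
      (ridgeParam n lamHat / (lamHat 0 - ridgeParam n lamHat) * ⟪uHat 0, v⟫) • uHat 0 := by
  set r := ridgeParam n lamHat with hrdef
  set A : Matrix (Fin p) (Fin p) ℝ := lamHat 0 • Matrix.vecMulVec (uHat 0) (uHat 0) -
    r • (1 : Matrix (Fin p) (Fin p) ℝ) with hA
  have hd : lamHat 0 - r ≠ 0 := sub_ne_zero.2 hl
  have huu : ⟪uHat 0, uHat 0⟫ = 1 := by rw [real_inner_self_eq_norm_sq, hu]; norm_num
  have hAx : ∀ x : Vec p, WithLp.toLp 2 (A.mulVec x) =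
      (lamHat 0 * ⟪uHat 0, x⟫) • uHat 0 - r • x := by
    intro x
    rw [hA, Matrix.sub_mulVec, Matrix.smul_mulVec, Matrix.smul_mulVec, WithLp.toLp_sub,
      WithLp.toLp_smul, WithLp.toLp_smul, toLp_vecMulVec_mulVec, Matrix.one_mulVec, smul_smul]
  -- Genuine invertibility is needed, because the matrix inverse is zero by convention when the
  -- determinant is not a unit.
  have hinj : Function.Injective A.mulVec := by
    refine (injective_iff_map_eq_zero (Matrix.mulVecLin A)).2 fun x hx => ?_
    have h1 := hAx (WithLp.toLp 2 x)
    have h2 : A.mulVec x = 0 := hx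
    rw [show A.mulVec (WithLp.toLp 2 x : Vec p) = A.mulVec x from rfl, h2, WithLp.toLp_zero] at h1
    have h3 := congrArg (fun y => ⟪uHat 0, y⟫) h1
    simp only [inner_zero_right, inner_sub_right, real_inner_smul_right, huu] at h3
    have h4 : ⟪uHat 0, (WithLp.toLp 2 x : Vec p)⟫ = 0 := by
      have : (lamHat 0 - r) * ⟪uHat 0, (WithLp.toLp 2 x : Vec p)⟫ = 0 := by linarith
      exact (mul_eq_zero.1 this).resolve_left hd
    rw [h4, mul_zero, zero_smul, zero_sub, zero_eq_neg] at h1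
    have h5 := (smul_eq_zero.1 h1).resolve_left hr
    simpa using h5
  have hunit : IsUnit A.det := (Matrix.isUnit_iff_isUnit_det A).1 (Matrix.mulVec_injective_iff_isUnit.1 hinj)
  set y := v - ⟪uHat 0, v⟫ • uHat 0 - (r / (lamHat 0 - r) * ⟪uHat 0, v⟫) • uHat 0 with hy
  have hAy : A.mulVec y = -r • (v : Fin p → ℝ) := by
    have h1 : WithLp.toLp 2 (A.mulVec y) = -r • v := by
      rw [hAx, hy]
      simp only [inner_sub_right, real_inner_smul_right, huu, smul_sub, smul_smul]
      rw [← sub_eq_zero]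
      have : lamHat 0 * (⟪uHat 0, v⟫ - ⟪uHat 0, v⟫ * 1 - r / (lamHat 0 - r) * ⟪uHat 0, v⟫ * 1) +
          r * ⟪uHat 0, v⟫ + r * (r / (lamHat 0 - r) * ⟪uHat 0, v⟫) = 0 := by
        field_simp; ring
      rw [show ∀ t : ℝ, (lamHat 0 * t) • uHat 0 - (r • v - (r * ⟪uHat 0, v⟫) • uHat 0 -
        (r * (r / (lamHat 0 - r) * ⟪uHat 0, v⟫)) • uHat 0) - -r • v = (lamHat 0 * t +
        r * ⟪uHat 0, v⟫ + r * (r / (lamHat 0 - r) * ⟪uHat 0, v⟫)) • uHat 0 from fun t => by module,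
        this, zero_smul]
    exact congrArg WithLp.ofLp h1
  have hfin : -r • (A⁻¹.mulVec v) = y := by
    rw [← Matrix.mulVec_smul, ← hAy, Matrix.mulVec_mulVec, Matrix.nonsing_inv_mul _ hunit,
      Matrix.one_mulVec]
  unfold ridgedDiscriminant
  rw [← WithLp.toLp_smul, ← hrdef, ← hA, hfin]

variable (hu : ‖uHat 0‖ = 1) (hv : ‖v‖ = 1) (hr : ridgeParam n lamHat ≠ 0)
  (hl : lamHat 0 ≠ ridgeParam n lamHat) (hc : ⟪uHat 0, v⟫ ^ 2 < 1)

include hu hv hr hl hc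

/-- Write `w = γ uHat₀ + β (v - c uHat₀)`. Orthogonality reads `β (1 - c²) = γ κ c` and unit length
reads `γ² + β² (1 - c²) = 1`. This fixes `w` up to sign, and the sign convention gives the absolute
value. -/
theorem IsARGDirection.inner_eq (h : IsARGDirection n lamHat uHat v u₁ w) :
    ⟪w, u₁⟫ = argCos (ridgeParam n lamHat / (lamHat 0 - ridgeParam n lamHat)) ⟪v, u₁⟫
      ⟪uHat 0, u₁⟫ ⟪uHat 0, v⟫ := by
  obtain ⟨hspan, horth⟩ := h.mem
  obtain ⟨α, β, rfl⟩ := Submodule.mem_span_pair.1 hspan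
  have horth := (Submodule.mem_orthogonal_singleton_iff_inner_right.1 horth)
  have hunit := h.unit
  have hsign := h.sign
  rw [ridgedDiscriminant_eq hu hr hl] at horth
  set κ := ridgeParam n lamHat / (lamHat 0 - ridgeParam n lamHat)
  have huu : ⟪uHat 0, uHat 0⟫ = 1 := by rw [real_inner_self_eq_norm_sq, hu]; norm_num
  have hvv : ⟪v, v⟫ = 1 := by rw [real_inner_self_eq_norm_sq, hv]; norm_num
  have hww : ⟪α • uHat 0 + β • v, α • uHat 0 + β • v⟫ = 1 := by
    rw [real_inner_self_eq_norm_sq, hunit]; norm_num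
  have hvu : ⟪v, uHat 0⟫ = ⟪uHat 0, v⟫ := real_inner_comm _ _
  simp only [inner_add_left, inner_add_right, inner_sub_left, real_inner_smul_left,
    real_inner_smul_right, huu, hvv, hvu] at horth hww hsign ⊢
  set a := ⟪v, u₁⟫
  set b := ⟪uHat 0, u₁⟫
  set c := ⟪uHat 0, v⟫
  have hc' : 0 < 1 - c ^ 2 := by linarith
  have hβ : β = (α + β * c) * (κ * c / (1 - c ^ 2)) := by
    field_simp; linear_combination horth
  set γ := α + β * c with hγ
  have hα : α = γ - β * c := by rw [hγ]; ring
  have hT : 0 < 1 + κ ^ 2 * c ^ 2 / (1 - c ^ 2) := by positivity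
  have hγ2 : γ ^ 2 * (1 + κ ^ 2 * c ^ 2 / (1 - c ^ 2)) = 1 := by
    have h1 : γ ^ 2 + β ^ 2 * (1 - c ^ 2) = 1 := by rw [hγ]; linear_combination hww
    rw [hβ] at h1
    refine Eq.trans ?_ h1
    field_simp
  have hval : α * b + β * a = γ * (b + κ * c * (a - c * b) / (1 - c ^ 2)) := by
    rw [hα]
    have h2 : γ * b + β * (a - c * b) = γ * (b + κ * c * (a - c * b) / (1 - c ^ 2)) := by
      rw [hβ]; ring
    linear_combination h2
  rw [← abs_of_nonneg hsign, hval, abs_mul, argCos, eq_div_iff (Real.sqrt_pos.2 hT).ne']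
  have h3 : |γ| * √(1 + κ ^ 2 * c ^ 2 / (1 - c ^ 2)) = 1 := by
    rw [← Real.sqrt_sq_eq_abs, ← Real.sqrt_mul (sq_nonneg γ), hγ2, Real.sqrt_one]
  linear_combination |b + κ * c * (a - c * b) / (1 - c ^ 2)| * h3

theorem exists_isARGDirection : ∃ w, IsARGDirection n lamHat uHat v u₁ w := by
  set κ := ridgeParam n lamHat / (lamHat 0 - ridgeParam n lamHat) with hκ
  have huu : ⟪uHat 0, uHat 0⟫ = 1 := by rw [real_inner_self_eq_norm_sq, hu]; norm_num
  have hvv : ⟪v, v⟫ = 1 := by rw [real_inner_self_eq_norm_sq, hv]; norm_num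
  have hvu : ⟪v, uHat 0⟫ = ⟪uHat 0, v⟫ := real_inner_comm _ _
  set c := ⟪uHat 0, v⟫ with hcdef
  have hc' : 0 < 1 - c ^ 2 := by linarith
  set β := κ * c / (1 - c ^ 2) with hβ
  -- The solution with `γ = 1`; its inner product with `uHat 0` is `1`, so it is nonzero and can be
  -- normalized.
  set w₀ := (1 - β * c) • uHat 0 + β • v with hw₀
  have hmem : w₀ ∈ Submodule.span ℝ {uHat 0, v} ⊓
      (Submodule.span ℝ {ridgedDiscriminant n lamHat uHat v})ᗮ := by
    refine ⟨Submodule.mem_span_pair.2 ⟨_, _, rfl⟩,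
      Submodule.mem_orthogonal_singleton_iff_inner_right.2 ?_⟩
    rw [ridgedDiscriminant_eq hu hr hl, ← hκ, ← hcdef, hw₀]
    simp only [inner_add_right, inner_sub_left, real_inner_smul_left,
      real_inner_smul_right, huu, hvv, hvu, ← hcdef]
    rw [hβ]
    field_simp
    ring
  have hne : w₀ ≠ 0 := by
    intro h0
    have h1 : ⟪uHat 0, w₀⟫ = 1 := by
      rw [hw₀]
      simp only [inner_add_right, real_inner_smul_right, huu, ← hcdef]
      ring
    rw [h0, inner_zero_right] at h1
    exact zero_ne_one h1
  have hnorm : ‖‖w₀‖⁻¹ • w₀‖ = 1 := norm_smul_inv_norm (𝕜 := ℝ) hne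
  rcases le_total 0 ⟪‖w₀‖⁻¹ • w₀, u₁⟫ with hs | hs
  · exact ⟨_, Submodule.smul_mem _ _ hmem, hnorm, hs⟩
  · exact ⟨-(‖w₀‖⁻¹ • w₀), Submodule.neg_mem _ (Submodule.smul_mem _ _ hmem), by rwa [norm_neg],
      by rw [inner_neg_left]; linarith⟩

end ARGDirection

/-- The limit of the cosine between the true and the ARG direction. -/
theorem argCos_limit {s τ a : ℝ} (hs : 0 < s) (hτ : 0 < τ) (ha : a ^ 2 ≤ 1) {a₁ : ℝ}
    (ha₁ : a₁ ^ 2 = a ^ 2) :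
    argCos (τ / s) a √(s / (s + τ)) (a * √(s / (s + τ))) = √(s / (s + τ) * gain τ a₁ s) := by
  have hst : 0 < s + τ := by positivity
  set b := √(s / (s + τ)) with hb
  have hb2 : b ^ 2 = s / (s + τ) := Real.sq_sqrt (by positivity)
  have hbpos : 0 < b := Real.sqrt_pos.2 (by positivity)
  have hb0 : 0 ≤ b := hbpos.le
  have hgain : 0 ≤ gain τ a₁ s := by
    unfold gain
    have : 0 ≤ 1 - a₁ ^ 2 := by rw [ha₁]; linarith
    positivity
  have hden : 0 < s * (1 - a ^ 2) + τ := by nlinarith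
  have h1c : 1 - (a * b) ^ 2 = (s * (1 - a ^ 2) + τ) / (s + τ) := by
    rw [mul_pow, hb2]; field_simp; ring
  -- The numerator is `b` times the gain and the radicand below is the same gain, so the quotient
  -- collapses to `b` times its square root.
  have h2 : b + τ / s * (a * b) * (a - a * b * b) / (1 - (a * b) ^ 2) =
      b * (1 + τ ^ 2 * a ^ 2 / (s * (s * (1 - a ^ 2) + τ))) := by
    rw [h1c, show a - a * b * b = a * (1 - b ^ 2) by ring, hb2]
    field_simp
    ring
  have h3 : 1 + (τ / s) ^ 2 * (a * b) ^ 2 / (1 - (a * b) ^ 2) =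
      1 + τ ^ 2 * a ^ 2 / (s * (s * (1 - a ^ 2) + τ)) := by
    rw [h1c, mul_pow a b, hb2]
    field_simp
  have h4 : gain τ a₁ s = 1 + τ ^ 2 * a ^ 2 / (s * (s * (1 - a ^ 2) + τ)) := by
    rw [gain, ha₁]; congr 2; ring
  rw [argCos, h2, h3, ← h4, abs_of_nonneg (mul_nonneg hb0 hgain), mul_div_assoc, Real.div_sqrt,
    Real.sqrt_mul (by positivity)]

theorem tendsto_argCos {ι : Type*} {l : Filter ι} {κ a b c : ι → ℝ} {κ' a' b' c' : ℝ}
    (hκ : Tendsto κ l (𝓝 κ')) (ha : Tendsto a l (𝓝 a')) (hb : Tendsto b l (𝓝 b'))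
    (hc : Tendsto c l (𝓝 c')) (hc' : c' ^ 2 < 1) :
    Tendsto (fun q => argCos (κ q) (a q) (b q) (c q)) l (𝓝 (argCos κ' a' b' c')) := by
  have h1 : 0 < 1 - c' ^ 2 := by linarith
  have h2 := (hc.pow 2).const_sub 1
  have h3 : 0 < 1 + κ' ^ 2 * c' ^ 2 / (1 - c' ^ 2) := by positivity
  exact ((hb.add (((hκ.mul hc).mul (ha.sub (hc.mul hb))).div h2 h1.ne')).abs).div
    (((((hκ.pow 2).mul (hc.pow 2)).div h2 h1.ne').const_add 1).sqrt) (Real.sqrt_pos.2 h3).ne'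

/-! ### Laws of large numbers -/

section LLN

variable {Ω : Type*} [MeasurableSpace Ω] {P : Measure Ω} [IsProbabilityMeasure P]

/-- Chebyshev's inequality, with `ε` split between the deviation from the mean and the drift of the
mean to `m`. -/
theorem tendstoInMeasure_sub_of_variance {W : ℕ → Ω → ℝ} {m : ℝ}
    (hW : ∀ᶠ p in atTop, MemLp (W p) 2 P) (hv : Tendsto (fun p => Var[W p; P]) atTop (𝓝 0))
    (hm : Tendsto (fun p => P[W p]) atTop (𝓝 m)) :
    TendstoInMeasure P (fun p ω => W p ω - m) atTop 0 := by
  rw [tendstoInMeasure_iff_norm]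
  intro ε hε
  have h1 : Tendsto (fun p => ENNReal.ofReal (Var[W p; P] / (ε / 2) ^ 2)) atTop (𝓝 0) := by
    simpa using ENNReal.tendsto_ofReal (hv.div_const ((ε / 2) ^ 2))
  refine tendsto_of_tendsto_of_tendsto_of_le_of_le' tendsto_const_nhds h1
    (Eventually.of_forall fun _ => zero_le) ?_
  filter_upwards [hW, Metric.tendsto_nhds.1 hm (ε / 2) (half_pos hε)] with p hp hpm
  refine le_trans (measure_mono fun ω hω => ?_) (meas_ge_le_variance_div_sq hp (half_pos hε))
  simp only [Pi.zero_apply, sub_zero, Real.norm_eq_abs, Set.mem_ofPred_eq] at hω ⊢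
  rw [Real.dist_eq] at hpm
  have := abs_add_le (W p ω - P[W p]) (P[W p] - m)
  rw [sub_add_sub_cancel] at this
  linarith

theorem abs_covariance_le {f g : Ω → ℝ} (hf : MemLp f 2 P) (hg : MemLp g 2 P) :
    |cov[f, g; P]| ≤ (Var[f; P] + Var[g; P]) / 2 := by
  have h1 := variance_nonneg (f + g) P
  have h2 := variance_nonneg (f - g) P
  rw [variance_add hf hg] at h1
  rw [variance_sub hf hg] at h2
  rw [abs_le]
  constructor <;> linarith

/-- Degenerate pairs contribute `0` to `maxCorr`, which then says nothing about their covariance; it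
vanishes because `f` is almost surely constant. -/
theorem covariance_eq_zero_of_variance_eq_zero {f g : Ω → ℝ} (hf : MemLp f 2 P)
    (h : Var[f; P] = 0) : cov[f, g; P] = 0 := by
  refine integral_eq_zero_of_ae ?_
  filter_upwards [ae_eq_integral_of_variance_eq_zero hf h] with ω hω
  simp [hω]

end LLN

/-- A bound on the maximal correlation bounds covariances. -/
theorem abs_covariance_le_of_maxCorr_le {Ω : Type*} {𝒜 ℬ : MeasurableSpace Ω}
    [mΩ : MeasurableSpace Ω] {P : Measure Ω} [IsProbabilityMeasure P] {ε V : ℝ} (hε : 0 ≤ ε)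
    (h : maxCorr P 𝒜 ℬ ≤ ENNReal.ofReal ε) {f g : Ω → ℝ} (hf : Measurable[𝒜] f)
    (hg : Measurable[ℬ] g) (hf2 : MemLp f 2 P) (hg2 : MemLp g 2 P) (hfV : Var[f; P] ≤ V)
    (hgV : Var[g; P] ≤ V) : |cov[f, g; P]| ≤ ε * V := by
  have hV : 0 ≤ V := (variance_nonneg f P).trans hfV
  rcases (variance_nonneg f P).eq_or_lt with h0 | h0
  · rw [covariance_eq_zero_of_variance_eq_zero hf2 h0.symm, abs_zero]; positivity
  rcases (variance_nonneg g P).eq_or_lt with h1 | h1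
  · rw [covariance_comm, covariance_eq_zero_of_variance_eq_zero hg2 h1.symm, abs_zero]; positivity
  have h2 : ENNReal.ofReal (|cov[f, g; P]| / (√Var[f; P] * √Var[g; P])) ≤ ENNReal.ofReal ε := by
    refine le_trans ?_ h
    unfold maxCorr
    refine le_iSup_of_le f ?_
    refine le_iSup_of_le g ?_
    exact le_iSup_of_le hf (le_iSup_of_le hg (le_iSup_of_le hf2 (le_iSup_of_le hg2 le_rfl)))
  have h3 : 0 < √Var[f; P] * √Var[g; P] := mul_pos (Real.sqrt_pos.2 h0) (Real.sqrt_pos.2 h1)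
  rw [ENNReal.ofReal_le_ofReal_iff hε, div_le_iff₀ h3] at h2
  refine h2.trans (mul_le_mul_of_nonneg_left ?_ hε)
  calc √Var[f; P] * √Var[g; P] ≤ √V * √V := by gcongr
    _ = V := Real.mul_self_sqrt hV

section LLN

variable {Ω : Type*} [MeasurableSpace Ω] {P : Measure Ω} [IsProbabilityMeasure P]

/-- Averages of covariances of a function of a sequence that is ρ-mixing after a permutation. -/
theorem tendsto_average_covariance_of_isRhoMixing {η : ℕ → Ω → ℝ} {π : Equiv.Perm ℕ}
    (hmix : IsRhoMixing P fun k => η (π k)) {φ : ℝ → ℝ} (hφ : Measurable φ)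
    (h2 : ∀ k, MemLp (fun ω => φ (η k ω)) 2 P) {V : ℝ}
    (hV : ∀ k, Var[fun ω => φ (η k ω); P] ≤ V) :
    Tendsto (fun p : ℕ => (∑ k ∈ Finset.range p, ∑ m ∈ Finset.range p,
      |cov[fun ω => φ (η k ω), fun ω => φ (η m ω); P]|) / (p : ℝ) ^ 2) atTop (𝓝 0) := by
  have hV0 : 0 ≤ V := (variance_nonneg _ P).trans (hV 0)
  -- The place of index `k` in the mixing order is `π.symm k`; separation is measured there.
  have hcov : ∀ ε > 0, ∃ D : ℕ, ∀ k m, (π.symm k) + D ≤ π.symm m →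
      |cov[fun ω => φ (η k ω), fun ω => φ (η m ω); P]| ≤ ε * V := by
    intro ε hε
    obtain ⟨D, hD⟩ := (ENNReal.tendsto_nhds_zero.1 hmix (ENNReal.ofReal ε)
      (ENNReal.ofReal_pos.2 hε)).exists
    refine ⟨D, fun k m hkm => ?_⟩
    refine abs_covariance_le_of_maxCorr_le hε.le
      ((le_iSup (fun j => maxCorr P (past (fun k => η (π k)) j)
        (future (fun k => η (π k)) (j + D))) (π.symm k)).trans hD)
      ?_ ?_ (h2 k) (h2 m) (hV k) (hV m)
    · have h3 : Measurable[MeasurableSpace.comap (η (π (π.symm k))) inferInstance] (η k) := by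
        rw [Equiv.apply_symm_apply]; exact comap_measurable _
      exact hφ.comp (h3.mono (le_iSup₂_of_le (π.symm k) le_rfl le_rfl) le_rfl)
    · have h3 : Measurable[MeasurableSpace.comap (η (π (π.symm m))) inferInstance] (η m) := by
        rw [Equiv.apply_symm_apply]; exact comap_measurable _
      exact hφ.comp (h3.mono (le_iSup₂_of_le (π.symm m) hkm le_rfl) le_rfl)
  have hbound : ∀ ε > 0, ∃ D : ℕ, ∀ p : ℕ, ∑ k ∈ Finset.range p, ∑ m ∈ Finset.range p,
      |cov[fun ω => φ (η k ω), fun ω => φ (η m ω); P]| ≤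
        p * (p * (ε * V) + 2 * D * V) := by
    intro ε hε
    obtain ⟨D, hD⟩ := hcov ε hε
    refine ⟨D, fun p => ?_⟩
    have hrow : ∀ k ∈ Finset.range p, ∑ m ∈ Finset.range p,
        |cov[fun ω => φ (η k ω), fun ω => φ (η m ω); P]| ≤ p * (ε * V) + 2 * D * V := by
      intro k _
      -- At most `2 D` indices lie within `D` of `k` in the mixing order, whatever the permutation.
      -- These cost at most `V` each, the others `ε V`.
      set N := (Finset.range p).filter
        fun m => π.symm m ∈ Finset.Ico (π.symm k - D) (π.symm k + D) with hN
      have hcard : N.card ≤ 2 * D := by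
        calc N.card ≤ (Finset.Ico (π.symm k - D) (π.symm k + D)).card :=
              Finset.card_le_card_of_injOn π.symm (fun m hm => (Finset.mem_filter.1 hm).2)
                π.symm.injective.injOn
          _ ≤ 2 * D := by rw [Nat.card_Ico]; omega
      have hpt : ∀ m ∈ Finset.range p, |cov[fun ω => φ (η k ω), fun ω => φ (η m ω); P]| ≤
          ε * V + if π.symm m ∈ Finset.Ico (π.symm k - D) (π.symm k + D) then V else 0 := by
        intro m _
        split_ifs with hm
        · have := abs_covariance_le (h2 k) (h2 m)
          have h4 : 0 ≤ ε * V := by positivity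
          linarith [hV k, hV m]
        · rw [add_zero]
          rw [Finset.mem_Ico, not_and_or, not_le, not_lt] at hm
          rcases hm with hm | hm
          · rw [covariance_comm]; exact hD m k (by omega)
          · exact hD k m hm
      refine (Finset.sum_le_sum hpt).trans ?_
      rw [Finset.sum_add_distrib, ← Finset.sum_filter, Finset.sum_const, Finset.sum_const,
        Finset.card_range, nsmul_eq_mul, nsmul_eq_mul, ← hN]
      gcongr
      exact_mod_cast hcard
    refine (Finset.sum_le_sum hrow).trans ?_
    rw [Finset.sum_const, Finset.card_range, nsmul_eq_mul]
  rw [Metric.tendsto_nhds]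
  intro δ hδ
  -- `V + 1` instead of `V` because `V` may vanish.
  obtain ⟨D, hD⟩ := hbound (δ / (2 * (V + 1))) (by positivity)
  have hlim : Tendsto (fun p : ℕ => (2 * D * V : ℝ) / p) atTop (𝓝 0) :=
    tendsto_const_div_atTop_nhds_zero_nat _
  filter_upwards [hlim.eventually_lt_const (half_pos hδ), eventually_gt_atTop 0] with p hp hp0
  have hp0' : (0 : ℝ) < p := Nat.cast_pos.2 hp0
  rw [Real.dist_eq, sub_zero, abs_of_nonneg (by positivity), div_lt_iff₀ (by positivity)]
  refine (hD p).trans_lt ?_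
  rw [div_lt_iff₀ hp0'] at hp
  have h5 : δ / (2 * (V + 1)) * V < δ / 2 := by
    rw [div_mul_eq_mul_div, div_lt_div_iff₀ (by positivity) two_pos]; nlinarith
  nlinarith

/-- Weights of size `B / p` bound the variance by `B²` times the averaged absolute covariances. -/
theorem tendsto_variance_weighted_sum {ξ : ℕ → Ω → ℝ} (h2 : ∀ k, MemLp (ξ k) 2 P)
    (hcov : Tendsto (fun p : ℕ => (∑ k ∈ Finset.range p, ∑ m ∈ Finset.range p,
      |cov[ξ k, ξ m; P]|) / (p : ℝ) ^ 2) atTop (𝓝 0))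
    {w : ℕ → ℕ → ℝ} {B : ℝ} (hw : ∀ᶠ p in atTop, ∀ k < p, |w p k| ≤ B / p) :
    Tendsto (fun p => Var[fun ω => ∑ k ∈ Finset.range p, w p k * ξ k ω; P]) atTop (𝓝 0) := by
  have h0 := hcov.const_mul (B ^ 2)
  rw [mul_zero] at h0
  refine tendsto_of_tendsto_of_tendsto_of_le_of_le' tendsto_const_nhds h0
    (Eventually.of_forall fun _ => variance_nonneg _ _) ?_
  filter_upwards [hw] with p hp
  rw [variance_fun_sum' fun k _ => (h2 k).const_mul (w p k), mul_div_assoc', mul_comm (B ^ 2),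
    mul_div_assoc, Finset.sum_mul]
  refine Finset.sum_le_sum fun k hk => ?_
  rw [Finset.sum_mul]
  refine Finset.sum_le_sum fun m hm => ?_
  rw [covariance_const_mul_left, covariance_const_mul_right]
  have hk' := hp k (Finset.mem_range.1 hk)
  have hm' := hp m (Finset.mem_range.1 hm)
  calc w p k * (w p m * cov[ξ k, ξ m; P])
      ≤ |w p k * (w p m * cov[ξ k, ξ m; P])| := le_abs_self _
    _ = |w p k| * |w p m| * |cov[ξ k, ξ m; P]| := by rw [abs_mul, abs_mul, mul_assoc]
    _ ≤ (B / p) * (B / p) * |cov[ξ k, ξ m; P]| := by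
        refine mul_le_mul_of_nonneg_right (mul_le_mul hk' hm' (abs_nonneg _)
          ((abs_nonneg _).trans hk')) (abs_nonneg _)
    _ = |cov[ξ k, ξ m; P]| * (B ^ 2 / p ^ 2) := by ring

end LLN

/-! ### Moments of the scores -/

section Scores

variable {Ω : Type*} [MeasurableSpace Ω] {P : Measure Ω} [IsProbabilityMeasure P]

namespace IsSample

variable {n p : ℕ} {X : Fin n → Ω → Vec p} {μ : Vec p} {C : Matrix (Fin p) (Fin p) ℝ}
  (h : IsSample P X μ C)

include h

theorem memLp_inner (a : Vec p) (i : Fin n) : MemLp (fun ω => ⟪a, X i ω - μ⟫) 2 P :=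
  ((h.memLp i).sub (memLp_const μ)).const_inner a

theorem integral_inner (a : Vec p) (i : Fin n) : ∫ ω, ⟪a, X i ω - μ⟫ ∂P = 0 := by
  have h1 : Integrable (X i) P := (h.memLp i).integrable one_le_two
  have h2 := _root_.integral_inner (𝕜 := ℝ) (h1.sub (integrable_const μ)) a
  simp only [Pi.sub_apply] at h2
  rw [h2, integral_sub h1 (integrable_const μ), h.mean i]
  simp

theorem covariance_inner (a b : Vec p) (i : Fin n) :
    cov[fun ω => ⟪a, X i ω - μ⟫, fun ω => ⟪b, X i ω - μ⟫; P] =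
      ∑ s, ∑ t, a s * b t * C s t := by
  have hc : ∀ s, MemLp (fun ω => X i ω s) 2 P := fun s => by
    have := (h.memLp i).const_inner (𝕜 := ℝ) (EuclideanSpace.single s (1 : ℝ) : Vec p)
    simpa [EuclideanSpace.inner_single_left] using this
  have hexp : ∀ (a : Vec p) (ω : Ω), ⟪a, X i ω - μ⟫ = ∑ s, a s * (X i ω s - μ s) := by
    intro a ω
    simp [PiLp.inner_apply, mul_comm]
  have hm : ∀ (a : Vec p) (s : Fin p), MemLp (fun ω => a s * (X i ω s - μ s)) 2 P :=
    fun a s => ((hc s).sub (memLp_const (μ s))).const_mul (a s)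
  simp only [hexp]
  rw [covariance_fun_sum_fun_sum (hm a) (hm b)]
  refine Finset.sum_congr rfl fun s _ => Finset.sum_congr rfl fun t _ => ?_
  rw [covariance_const_mul_left, covariance_const_mul_right,
    covariance_sub_const_left ((hc s).integrable one_le_two),
    covariance_sub_const_right ((hc t).integrable one_le_two), h.cov]
  ring

end IsSample

theorem IsEigendecomposition.sum_mul_mul {p : ℕ} {C : Matrix (Fin p) (Fin p) ℝ} {lam : ℕ → ℝ}
    {u : ℕ → Vec p} (h : IsEigendecomposition C lam u) {k m : ℕ} (hk : k < p) (hm : m < p) :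
    ∑ s, ∑ t, u k s * u m t * C s t = if k = m then lam k else 0 := by
  have hu : ∀ {k m : ℕ}, k < p → m < p → ∑ s, u k s * u m s = if k = m then 1 else 0 := by
    intro k m hk hm
    have := orthonormal_iff_ite.1 h.orthonormal ⟨k, hk⟩ ⟨m, hm⟩
    simpa [Fin.ext_iff, PiLp.inner_apply, mul_comm] using this
  have h1 : ∑ s, ∑ t, u k s * u m t * C s t =
      ∑ r ∈ Finset.range p, lam r * ((∑ s, u k s * u r s) * ∑ t, u m t * u r t) := by
    rw [h.eq_sum]
    simp only [Matrix.sum_apply, Matrix.smul_apply, Matrix.vecMulVec_apply, smul_eq_mul,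
      Finset.mul_sum, Finset.sum_mul]
    rw [Finset.sum_comm' (t' := Finset.univ) (s' := fun _ => Finset.univ) (by simp)]
    rw [Finset.sum_congr rfl fun t _ => Finset.sum_comm, Finset.sum_comm]
    refine Finset.sum_congr rfl fun r _ => Finset.sum_congr rfl fun t _ =>
      Finset.sum_congr rfl fun s _ => by ring
  rw [h1, Finset.sum_eq_single_of_mem m (Finset.mem_range.2 hm)]
  · rw [hu hk hm, hu hm hm, if_pos rfl]
    split_ifs with hkm
    · rw [hkm]; ring
    · ring
  · intro r hr hrm
    rw [hu hm (Finset.mem_range.1 hr), if_neg (Ne.symm hrm)]; ring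

theorem SingleSpike.lam_pos {n : ℕ} {lam : ℕ → ℕ → ℝ} {σsq τsq : ℝ} {τs : ℕ → ℕ → ℝ}
    (h : SingleSpike n lam σsq τsq τs) {p : ℕ} (hp : n < p) {k : ℕ} (hk : k < p) :
    0 < lam p k := by
  have hτ := h.τs_pos p hp k hk
  rcases Nat.eq_zero_or_pos k with rfl | hk0
  · rw [h.spiked p hp]
    have := mul_nonneg h.σsq_pos.le (Nat.cast_nonneg (α := ℝ) p)
    linarith
  · rwa [h.nonspiked p hp k hk0 hk]

/-- What the laws of large numbers need to know about the scores. -/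
structure ScoreMoments (P : Measure Ω) {n : ℕ} (z : ℕ → Fin n → Ω → ℝ) : Prop where
  measurable : ∀ k i, Measurable (z k i)
  memLp : ∀ k i, MemLp (z k i) 2 P
  memLp_sq : ∀ k i, MemLp (fun ω => z k i ω ^ 2) 2 P
  variance_sq : ∃ V : ℝ, ∀ k i, Var[fun ω => z k i ω ^ 2; P] ≤ V
  mean : ∀ k i, ∫ ω, z k i ω ∂P = 0
  integral_mul : ∀ k m i, ∫ ω, z k i ω * z m i ω ∂P = if k = m then 1 else 0
  indep : ∀ k m i j, i ≠ j →
    IndepFun (fun ω => z k i ω * z m i ω) (fun ω => z k j ω * z m j ω) P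
  indep_score : ∀ k i j, i ≠ j → IndepFun (z k i) (z k j) P
  noAtoms : ∀ i t, P {ω | z 0 i ω = t} = 0
  mixing : ∀ i, ∃ π : Equiv.Perm ℕ, IsRhoMixing P fun k => z (π k) i

/-- The infinite sequence does not depend on `p`, and apart from mixing each property involves at
most two score indices. One dimension containing both therefore suffices. -/
theorem ScoreCondition.scoreMoments {n : ℕ} {X : (p : ℕ) → Fin n → Ω → Vec p}
    {μ : (p : ℕ) → Vec p} {C : (p : ℕ) → Matrix (Fin p) (Fin p) ℝ} {lam : ℕ → ℕ → ℝ}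
    {u : (p : ℕ) → ℕ → Vec p} (hX : ∀ p, n < p → IsSample P (X p) (μ p) (C p))
    (hC : ∀ p, n < p → IsEigendecomposition (C p) (lam p) (u p))
    {σsq τsq : ℝ} {τs : ℕ → ℕ → ℝ} (hspike : SingleSpike n lam σsq τsq τs)
    {z : ℕ → Fin n → Ω → ℝ} (hz : ScoreCondition P X μ lam u z) : ScoreMoments P z := by
  obtain ⟨B, hB⟩ := hz.fourthMoment
  have hfun : ∀ p, n < p → ∀ k, k < p → ∀ i,
      z k i = fun ω => (√(lam p k))⁻¹ * ⟪u p k, X p i ω - μ p⟫ := fun p hp k hk i =>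
    funext fun ω => (hz.truncation p hp k hk i ω).symm
  have hφ : ∀ p k, Measurable fun x : Vec p => (√(lam p k))⁻¹ * ⟪u p k, x - μ p⟫ := fun p k => by
    fun_prop
  have hdim : ∀ k m, ∃ p, n < p ∧ k < p ∧ m < p := fun k m =>
    ⟨n + k + m + 1, by omega, by omega, by omega⟩
  have hmeas : ∀ k i, Measurable (z k i) := by
    intro k i
    obtain ⟨p, hp, hk, -⟩ := hdim k k
    rw [hfun p hp k hk i]
    exact (hφ p k).comp ((hX p hp).measurable i)
  have hmem : ∀ k i, MemLp (z k i) 2 P := by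
    intro k i
    obtain ⟨p, hp, hk, -⟩ := hdim k k
    rw [hfun p hp k hk i]
    exact ((hX p hp).memLp_inner _ i).const_mul _
  have hmean : ∀ k i, ∫ ω, z k i ω ∂P = 0 := by
    intro k i
    obtain ⟨p, hp, hk, -⟩ := hdim k k
    rw [hfun p hp k hk i, integral_const_mul, (hX p hp).integral_inner, mul_zero]
  have hint4 : ∀ k i, Integrable (fun ω => z k i ω ^ 4) P := by
    intro k i
    rw [← lintegral_ofReal_ne_top_iff_integrable ((hmeas k i).pow_const 4).aestronglyMeasurable
      (Eventually.of_forall fun ω => by positivity)]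
    exact ((hB k i).trans_lt ENNReal.ofReal_lt_top).ne
  have hmem2 : ∀ k i, MemLp (fun ω => z k i ω ^ 2) 2 P := by
    intro k i
    rw [memLp_two_iff_integrable_sq ((hmeas k i).pow_const 2).aestronglyMeasurable]
    simpa [← pow_mul] using hint4 k i
  refine ⟨hmeas, hmem, hmem2, ⟨max B 0, fun k i => ?_⟩, hmean, ?_, ?_, ?_, ?_, hz.rhoMixing⟩
  · refine (variance_le_expectation_sq ((hmeas k i).pow_const 2).aestronglyMeasurable).trans ?_
    have h1 := hB k i
    rw [← ofReal_integral_eq_lintegral_ofReal (hint4 k i)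
      (Eventually.of_forall fun ω => by positivity)] at h1
    -- `ENNReal.ofReal B` is zero for negative `B`, whence the maximum.
    have h2 : ∫ ω, z k i ω ^ 4 ∂P ≤ max B 0 := by
      rcases le_or_gt B 0 with hB0 | hB0
      · rw [ENNReal.ofReal_of_nonpos hB0] at h1
        exact (ENNReal.ofReal_eq_zero.1 (le_antisymm h1 zero_le)).trans (le_max_right _ _)
      · exact ((ENNReal.ofReal_le_ofReal_iff hB0.le).1 h1).trans (le_max_left _ _)
    refine le_trans (le_of_eq ?_) h2
    exact integral_congr_ae (Eventually.of_forall fun ω => by simp [← pow_mul])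
  · intro k m i
    obtain ⟨p, hp, hk, hm⟩ := hdim k m
    have h1 : cov[z k i, z m i; P] = if k = m then 1 else 0 := by
      rw [hfun p hp k hk i, hfun p hp m hm i, covariance_const_mul_left,
        covariance_const_mul_right, (hX p hp).covariance_inner, (hC p hp).sum_mul_mul hk hm]
      split_ifs with hkm
      · subst hkm
        rw [← mul_assoc, ← mul_inv, Real.mul_self_sqrt (hspike.lam_pos hp hk).le,
          inv_mul_cancel₀ (hspike.lam_pos hp hk).ne']
      · ring
    rw [covariance_eq_sub (hmem k i) (hmem m i), hmean, hmean, mul_zero, sub_zero] at h1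
    exact h1
  · intro k m i j hij
    obtain ⟨p, hp, hk, hm⟩ := hdim k m
    rw [hfun p hp k hk i, hfun p hp m hm i, hfun p hp k hk j, hfun p hp m hm j]
    exact ((hX p hp).indep.indepFun hij).comp ((hφ p k).mul (hφ p m)) ((hφ p k).mul (hφ p m))
  · intro k i j hij
    obtain ⟨p, hp, hk, -⟩ := hdim k k
    rw [hfun p hp k hk i, hfun p hp k hk j]
    exact ((hX p hp).indep.indepFun hij).comp (hφ p k) (hφ p k)
  · intro i t
    obtain ⟨p, hp, hk, -⟩ := hdim 0 0
    -- A level set of the score lies in an affine hyperplane, which is Lebesgue null.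
    have hvol : volume {x : Vec p | (√(lam p 0))⁻¹ * ⟪u p 0, x - μ p⟫ = t} = 0 := by
      have hne : (√(lam p 0))⁻¹ ≠ 0 := inv_ne_zero (Real.sqrt_pos.2 (hspike.lam_pos hp hk)).ne'
      have hunit : ‖u p 0‖ = 1 := (hC p hp).orthonormal.1 ⟨0, hk⟩
      have huu : ⟪u p 0, u p 0⟫ = 1 := by rw [real_inner_self_eq_norm_sq, hunit]; norm_num
      set r := √(lam p 0) * t + ⟪u p 0, μ p⟫ with hr
      have hsub : {x : Vec p | (√(lam p 0))⁻¹ * ⟪u p 0, x - μ p⟫ = t} ⊆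
          (AffineSubspace.mk' (r • u p 0) (Submodule.span ℝ {u p 0})ᗮ : Set (Vec p)) := by
        intro x hx
        rw [SetLike.mem_coe, AffineSubspace.mem_mk', vsub_eq_sub,
          Submodule.mem_orthogonal_singleton_iff_inner_right, inner_sub_right,
          real_inner_smul_right, huu, hr, ← (show (√(lam p 0))⁻¹ * ⟪u p 0, x - μ p⟫ = t from hx),
          inner_sub_right]
        have := inv_ne_zero hne
        rw [inv_inv] at this
        field_simp
        ring
      refine measure_mono_null hsub (Measure.addHaar_affineSubspace _ _ fun htop => ?_)
      have h1 : (Submodule.span ℝ {u p 0})ᗮ = ⊤ := by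
        have := congrArg AffineSubspace.direction htop
        rwa [AffineSubspace.direction_mk', AffineSubspace.direction_top] at this
      have h2 : u p 0 ∈ (Submodule.span ℝ {u p 0})ᗮ := h1 ▸ Submodule.mem_top
      rw [Submodule.mem_orthogonal_singleton_iff_inner_right, huu] at h2
      exact one_ne_zero h2
    have h3 := (hX p hp).absolutelyContinuous i hvol
    rw [Measure.map_apply ((hX p hp).measurable i)
      (measurableSet_eq_fun (hφ p 0) measurable_const)] at h3
    rw [hfun p hp 0 hk i]
    exact h3

namespace ScoreMoments

variable {n : ℕ} {z : ℕ → Fin n → Ω → ℝ} (h : ScoreMoments P z)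

include h

/-- By independence the joint law is a product, and Fubini gives the diagonal measure zero because
there are no atoms. -/
theorem ae_ne {i j : Fin n} (hij : i ≠ j) : ∀ᵐ ω ∂P, z 0 i ω ≠ z 0 j ω := by
  have h1 := (indepFun_iff_map_prod_eq_prod_map_map (h.measurable 0 i).aemeasurable
    (h.measurable 0 j).aemeasurable).1 (h.indep_score 0 i j hij)
  have hms : MeasurableSet {q : ℝ × ℝ | q.1 = q.2} := measurableSet_eq_fun measurable_fst measurable_snd
  have h2 : P.map (fun ω => (z 0 i ω, z 0 j ω)) {q : ℝ × ℝ | q.1 = q.2} = 0 := by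
    rw [h1, Measure.prod_apply_symm hms]
    refine lintegral_eq_zero_of_ae_eq_zero (Eventually.of_forall fun t => ?_)
    refine (Measure.map_apply (h.measurable 0 i) (measurable_prodMk_right hms)).trans ?_
    exact h.noAtoms i t
  rw [Measure.map_apply ((h.measurable 0 i).prodMk (h.measurable 0 j)) hms] at h2
  rw [ae_iff]
  simpa using h2

theorem memLp_mul (k : ℕ) (i j : Fin n) : MemLp (fun ω => z k i ω * z k j ω) 2 P := by
  refine (memLp_two_iff_integrable_sq
    ((h.measurable k i).mul (h.measurable k j)).aestronglyMeasurable).2 ?_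
  have := (h.memLp_sq k i).integrable_mul (h.memLp_sq k j)
  refine this.congr (Eventually.of_forall fun ω => ?_)
  simp [mul_pow]

theorem integral_mul_of_ne (k : ℕ) {i j : Fin n} (hij : i ≠ j) :
    ∫ ω, z k i ω * z k j ω ∂P = 0 := by
  rw [(h.indep_score k i j hij).integral_fun_mul_eq_mul_integral
    (h.measurable k i).aestronglyMeasurable (h.measurable k j).aestronglyMeasurable, h.mean,
    zero_mul]

theorem covariance_eq (k m : ℕ) (i : Fin n) : cov[z k i, z m i; P] = if k = m then 1 else 0 := by
  rw [covariance_eq_sub (h.memLp k i) (h.memLp m i), h.mean, zero_mul, sub_zero]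
  exact h.integral_mul k m i

/-- The expectation of the fourfold product factors over the independent observations `i` and `j`.
-/
theorem covariance_mul_of_ne (k m : ℕ) {i j : Fin n} (hij : i ≠ j) :
    cov[fun ω => z k i ω * z k j ω, fun ω => z m i ω * z m j ω; P] = if k = m then 1 else 0 := by
  rw [covariance_eq_sub (h.memLp_mul k i j) (h.memLp_mul m i j), h.integral_mul_of_ne k hij,
    zero_mul, sub_zero]
  have h1 : ∫ ω, (z k i ω * z m i ω) * (z k j ω * z m j ω) ∂P =
      (∫ ω, z k i ω * z m i ω ∂P) * ∫ ω, z k j ω * z m j ω ∂P :=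
    (h.indep k m i j hij).integral_fun_mul_eq_mul_integral
      ((h.measurable k i).mul (h.measurable m i)).aestronglyMeasurable
      ((h.measurable k j).mul (h.measurable m j)).aestronglyMeasurable
  rw [h.integral_mul, h.integral_mul] at h1
  calc _ = ∫ ω, (z k i ω * z m i ω) * (z k j ω * z m j ω) ∂P :=
        integral_congr_ae (Eventually.of_forall fun ω => by simp only [Pi.mul_apply]; ring)
    _ = _ := by rw [h1]; split_ifs <;> simp

/-- For `i = j` this is mixing applied to squares. For `i ≠ j` independence leaves only `p` nonzero
terms among `p²`. -/
theorem tendsto_average_covariance_mul (i j : Fin n) :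
    Tendsto (fun p : ℕ => (∑ k ∈ Finset.range p, ∑ m ∈ Finset.range p,
      |cov[fun ω => z k i ω * z k j ω, fun ω => z m i ω * z m j ω; P]|) / (p : ℝ) ^ 2)
      atTop (𝓝 0) := by
  by_cases hij : i = j
  · subst hij
    obtain ⟨π, hπ⟩ := h.mixing i
    obtain ⟨V, hV⟩ := h.variance_sq
    simp only [← sq]
    exact tendsto_average_covariance_of_isRhoMixing (η := fun k => z k i) hπ
      (φ := fun x => x ^ 2) (measurable_id.pow_const 2) (fun k => h.memLp_sq k i) (fun k => hV k i)
  · simp only [h.covariance_mul_of_ne _ _ hij]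
    refine (tendsto_const_div_atTop_nhds_zero_nat (1 : ℝ)).congr' ?_
    filter_upwards [eventually_gt_atTop 0] with p hp
    have hp' : (p : ℝ) ≠ 0 := by positivity
    have h1 : ∑ k ∈ Finset.range p, ∑ m ∈ Finset.range p, |if k = m then (1 : ℝ) else 0| = p := by
      rw [Finset.sum_congr rfl (g := fun _ => (1 : ℝ))]
      · simp
      · intro k hk
        rw [Finset.sum_eq_single_of_mem k hk]
        · simp
        · intro m _ hm
          simp [Ne.symm hm]
    rw [h1]
    field_simp

/-- The average of products of non-spiked scores converges to `τ² I`. -/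
theorem tendstoInMeasure_gram {lam : ℕ → ℕ → ℝ} {σsq τsq : ℝ} {τs : ℕ → ℕ → ℝ}
    (hspike : SingleSpike n lam σsq τsq τs) (i j : Fin n) :
    TendstoInMeasure P (fun p ω => ∑ k ∈ Finset.range p, τs p k / p * (z k i ω * z k j ω) -
      τsq * if i = j then 1 else 0) atTop 0 := by
  obtain ⟨B, hB⟩ := hspike.bounded
  refine tendstoInMeasure_sub_of_variance (Eventually.of_forall fun p =>
    memLp_finsetSum _ fun k _ => (h.memLp_mul k i j).const_mul _)
    (tendsto_variance_weighted_sum (B := B) (fun k => h.memLp_mul k i j)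
      (h.tendsto_average_covariance_mul i j) ?_) ?_
  · filter_upwards [eventually_gt_atTop n] with p hp k hk
    rw [abs_of_nonneg (div_nonneg (hspike.τs_pos p hp k hk).le (Nat.cast_nonneg p))]
    exact div_le_div_of_nonneg_right (hB p hp k hk) (Nat.cast_nonneg p)
  · have h1 : ∀ k, ∫ ω, z k i ω * z k j ω ∂P = if i = j then 1 else 0 := fun k => by
      split_ifs with hij
      · subst hij; simpa using h.integral_mul k k i
      · exact h.integral_mul_of_ne k hij
    have h2 : ∀ p : ℕ, ∫ ω, ∑ k ∈ Finset.range p, τs p k / p * (z k i ω * z k j ω) ∂P =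
        (∑ k ∈ Finset.range p, τs p k) / p * if i = j then 1 else 0 := fun p => by
      rw [integral_finsetSum _ fun k _ =>
        ((h.memLp_mul k i j).const_mul _).integrable one_le_two]
      simp only [integral_const_mul, h1]
      rw [← Finset.sum_mul, Finset.sum_div]
    simp only [h2]
    exact hspike.average.mul_const _

/-- The non-spiked part of the projection of the data on a unit vector is negligible. -/
theorem tendstoInMeasure_reference {lam : ℕ → ℕ → ℝ} {σsq τsq : ℝ} {τs : ℕ → ℕ → ℝ}
    (hspike : SingleSpike n lam σsq τsq τs) {u : (p : ℕ) → ℕ → Vec p}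
    (hu : ∀ p, n < p → Orthonormal ℝ fun k : Fin p => u p k) {v : (p : ℕ) → Vec p}
    (hv : ∀ p, n < p → ‖v p‖ = 1) (i : Fin n) :
    TendstoInMeasure P (fun p ω => ∑ k ∈ Finset.range p,
      (if k = 0 then 0 else √(τs p k) * ⟪u p k, v p⟫ / √p) * z k i ω) atTop 0 := by
  obtain ⟨B, hB⟩ := hspike.bounded
  have hmean : ∀ p : ℕ, ∫ ω, ∑ k ∈ Finset.range p,
      (if k = 0 then 0 else √(τs p k) * ⟪u p k, v p⟫ / √p) * z k i ω ∂P = 0 := fun p => by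
    rw [integral_finsetSum _ fun k _ => ((h.memLp k i).const_mul _).integrable one_le_two]
    simp only [integral_const_mul, h.mean, mul_zero, Finset.sum_const_zero]
  have hvar : ∀ p : ℕ, Var[fun ω => ∑ k ∈ Finset.range p,
      (if k = 0 then 0 else √(τs p k) * ⟪u p k, v p⟫ / √p) * z k i ω; P] =
      ∑ k ∈ Finset.range p, (if k = 0 then 0 else √(τs p k) * ⟪u p k, v p⟫ / √p) ^ 2 := fun p => by
    rw [variance_fun_sum' fun k _ => (h.memLp k i).const_mul _]
    refine Finset.sum_congr rfl fun k hk => ?_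
    simp only [covariance_const_mul_left, covariance_const_mul_right, h.covariance_eq]
    rw [Finset.sum_eq_single_of_mem k hk]
    · rw [if_pos rfl, mul_one, sq]
    · intro m _ hm
      simp [Ne.symm hm]
  have key := tendstoInMeasure_sub_of_variance (P := P) (m := 0)
    (W := fun p ω => ∑ k ∈ Finset.range p,
      (if k = 0 then 0 else √(τs p k) * ⟪u p k, v p⟫ / √p) * z k i ω)
    (Eventually.of_forall fun p => memLp_finsetSum _ fun k _ => (h.memLp k i).const_mul _)
    ?_ (by simp only [hmean]; exact tendsto_const_nhds)
  · simpa only [sub_zero] using key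
  simp only [hvar]
  refine tendsto_of_tendsto_of_tendsto_of_le_of_le' tendsto_const_nhds
    (tendsto_const_div_atTop_nhds_zero_nat B)
    (Eventually.of_forall fun p => Finset.sum_nonneg fun _ _ => sq_nonneg _) ?_
  filter_upwards [eventually_gt_atTop n] with p hp
  have hp0 : (0 : ℝ) < p := Nat.cast_pos.2 (by omega)
  have hB0 : 0 ≤ B := (hspike.τs_pos p hp 0 (by omega)).le.trans (hB p hp 0 (by omega))
  -- Bessel's inequality for the unit vector `v p` gives the bound `B / p`.
  calc ∑ k ∈ Finset.range p, (if k = 0 then 0 else √(τs p k) * ⟪u p k, v p⟫ / √p) ^ 2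
      ≤ ∑ k ∈ Finset.range p, B / p * ⟪u p k, v p⟫ ^ 2 := by
        refine Finset.sum_le_sum fun k hk => ?_
        have hk' := Finset.mem_range.1 hk
        split_ifs
        · rw [zero_pow two_ne_zero]; positivity
        · rw [div_pow, mul_pow, Real.sq_sqrt (hspike.τs_pos p hp k hk').le, Real.sq_sqrt hp0.le,
            mul_div_right_comm]
          gcongr
          exact hB p hp k hk'
    _ = B / p * ∑ k : Fin p, ‖⟪u p k, v p⟫‖ ^ 2 := by
        rw [← Finset.mul_sum, Finset.sum_range]; simp
    _ ≤ B / p * 1 := by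
        gcongr
        have := (hu p hp).sum_inner_products_le (s := Finset.univ) (v p)
        rwa [hv p hp, one_pow] at this
    _ = B / p := mul_one _

end ScoreMoments

end Scores

/-! ### The scatter of the spike -/

section Scatter

variable {n : ℕ}

/-- `I - J` is a symmetric idempotent, namely centering. -/
theorem spikeScatter_eq (hn : n ≠ 0) (α : ℝ) (ζ : Fin n → ℝ) :
    spikeScatter α ζ = α * ∑ i, center ζ i ^ 2 := by
  have h0 : (n : ℝ) ≠ 0 := Nat.cast_ne_zero.2 hn
  have h1 : ∀ i, (((1 - (n : ℝ)⁻¹ • Matrix.of fun _ _ => (1 : ℝ)) : Matrix (Fin n) (Fin n) ℝ).mulVec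
      ζ) i = center ζ i := fun i => by
    rw [Matrix.sub_mulVec, Matrix.one_mulVec, Matrix.smul_mulVec]
    simp [center, Matrix.mulVec, dotProduct]
  have h2 : ∑ i, center ζ i ^ 2 = ∑ i, ζ i * center ζ i := by
    have h3 : ∀ i, center ζ i ^ 2 = ζ i * center ζ i - (n : ℝ)⁻¹ * (∑ j, ζ j) * center ζ i :=
      fun i => by simp only [center]; ring
    simp only [h3, Finset.sum_sub_distrib, ← Finset.mul_sum, sum_center hn, mul_zero, sub_zero]
  rw [spikeScatter, h2, dotProduct]
  simp only [h1]

theorem continuous_spikeScatter (hn : n ≠ 0) (α : ℝ) :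
    Continuous (spikeScatter α : (Fin n → ℝ) → ℝ) := by
  have : (spikeScatter α : (Fin n → ℝ) → ℝ) = fun ζ => α * ∑ i, center ζ i ^ 2 :=
    funext (spikeScatter_eq hn α)
  rw [this]
  unfold center
  fun_prop

/-- Zero scatter would force all coordinates to agree. -/
theorem spikeScatter_pos {α : ℝ} (hα : 0 < α) {ζ : Fin n → ℝ} {i j : Fin n} (h : ζ i ≠ ζ j) :
    0 < spikeScatter α ζ := by
  have hn : n ≠ 0 := fun h0 => by subst h0; exact i.elim0
  rw [spikeScatter_eq hn]
  refine mul_pos hα (lt_of_le_of_ne (Finset.sum_nonneg fun _ _ => sq_nonneg _) fun h0 => h ?_)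
  have h1 := (Finset.sum_eq_zero_iff_of_nonneg fun k _ => sq_nonneg (center ζ k)).1 h0.symm
  have hi := pow_eq_zero_iff two_ne_zero |>.1 (h1 i (Finset.mem_univ i))
  have hj := pow_eq_zero_iff two_ne_zero |>.1 (h1 j (Finset.mem_univ j))
  simp only [center] at hi hj
  linarith

/-- Centering both indices conjugates `α ζ ζᵀ + τ I` by `I - J`. -/
theorem center_center_spiked (hn : n ≠ 0) (α τ : ℝ) (ζ : Fin n → ℝ) (i j : Fin n) :
    center (fun k => center (fun k' => α * ζ k * ζ k' + τ * if k = k' then 1 else 0) j) i =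
      α * center ζ i * center ζ j + τ * ((if i = j then 1 else 0) - (n : ℝ)⁻¹) := by
  have h0 : (n : ℝ) ≠ 0 := Nat.cast_ne_zero.2 hn
  have h1 : ∀ k, center (fun k' => α * ζ k * ζ k' + τ * if k = k' then 1 else 0) j =
      α * ζ k * center ζ j + τ * ((if k = j then 1 else 0) - (n : ℝ)⁻¹) := fun k => by
    simp only [center, Finset.sum_add_distrib, ← Finset.mul_sum, Finset.sum_ite_eq,
      Finset.mem_univ, if_true]
    ring
  simp only [h1]
  simp only [center, Finset.sum_add_distrib, ← Finset.mul_sum, ← Finset.sum_mul,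
    Finset.sum_sub_distrib, Finset.sum_ite_eq', Finset.mem_univ, if_true, Finset.sum_const,
    Finset.card_univ, Fintype.card_fin, nsmul_eq_mul]
  field_simp
  ring

end Scatter

/-! ### Scaled identities for the leading sample eigenpair -/

namespace IsSamplePCA

variable {n p : ℕ} {x : Fin n → Vec p} {u : ℕ → Vec p} {lamHat : ℕ → ℝ} {uHat : ℕ → Vec p}
  (h : IsSamplePCA x u lamHat uHat)

include h

theorem sum_scaled_sq (hn : 1 < n) :
    ∑ j, (⟪x j - sampleMean x, uHat 0⟫ / √p) ^ 2 = n * lamHat 0 / p := by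
  simp only [div_pow, Real.sq_sqrt (Nat.cast_nonneg (α := ℝ) p)]
  rw [← Finset.sum_div, h.sum_inner_uHat_sq (by omega) (by omega)]

theorem sum_scaled_mul (hn : 1 < n) (a : Vec p) :
    ∑ j, ⟪x j - sampleMean x, uHat 0⟫ / √p * (⟪x j - sampleMean x, a⟫ / √p) =
      n * lamHat 0 / p * ⟪uHat 0, a⟫ := by
  simp only [div_mul_div_comm, Real.mul_self_sqrt (Nat.cast_nonneg (α := ℝ) p)]
  rw [← Finset.sum_div, h.sum_inner_uHat_mul_inner (by omega) (by omega), mul_div_right_comm]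

/-- The scores of the data on `uHat 0` form an eigenvector of the dual Gram matrix, with the
eigenvalue of `uHat 0` rescaled. -/
theorem sum_scaled_gram (hn : 1 < n) :
    ∑ i, ∑ j, ⟪x i - sampleMean x, uHat 0⟫ / √p * (⟪x j - sampleMean x, uHat 0⟫ / √p) *
      (⟪x i - sampleMean x, x j - sampleMean x⟫ / p) = (n * lamHat 0 / p) ^ 2 := by
  have h1 : ∀ i, ∑ j, ⟪x i - sampleMean x, uHat 0⟫ / √p * (⟪x j - sampleMean x, uHat 0⟫ / √p) *
      (⟪x i - sampleMean x, x j - sampleMean x⟫ / p) =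
      n * lamHat 0 / p * (⟪x i - sampleMean x, uHat 0⟫ / √p) ^ 2 := by
    intro i
    have h2 := h.sum_inner_uHat_mul_inner (by omega) (show 0 < n - 1 by omega)
      (x i - sampleMean x)
    rw [real_inner_comm] at h2
    have h3 : ∀ j, ⟪x i - sampleMean x, uHat 0⟫ / √p * (⟪x j - sampleMean x, uHat 0⟫ / √p) *
        (⟪x i - sampleMean x, x j - sampleMean x⟫ / p) =
        ⟪x i - sampleMean x, uHat 0⟫ / √p / √p / p *
          (⟪x j - sampleMean x, uHat 0⟫ * ⟪x j - sampleMean x, x i - sampleMean x⟫) := by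
      intro j
      rw [real_inner_comm (x j - sampleMean x) (x i - sampleMean x)]
      ring
    simp only [h3, ← Finset.mul_sum]
    rw [h2]
    ring
  simp only [h1, ← Finset.mul_sum]
  rw [h.sum_scaled_sq hn, sq]

/-- This is the Rayleigh bound for `S` at the combination `a` of the centered data with coefficients
`w`. -/
theorem sum_scaled_rayleigh (hn : 1 < n) (w : Fin n → ℝ) :
    ∑ j, (∑ i, w i * (⟪x j - sampleMean x, x i - sampleMean x⟫ / p)) ^ 2 ≤
      n * lamHat 0 / p * ∑ i, ∑ j, w i * w j * (⟪x i - sampleMean x, x j - sampleMean x⟫ / p) := by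
  set a := ∑ i, w i • (x i - sampleMean x) with ha
  have h1 : ∀ j, ∑ i, w i * (⟪x j - sampleMean x, x i - sampleMean x⟫ / p) =
      ⟪x j - sampleMean x, a⟫ / p := fun j => by
    rw [ha, inner_sum, Finset.sum_div]
    exact Finset.sum_congr rfl fun i _ => by rw [real_inner_smul_right]; ring
  have h2 : ∑ i, ∑ j, w i * w j * (⟪x i - sampleMean x, x j - sampleMean x⟫ / p) =
      ‖a‖ ^ 2 / p := by
    have h3 : ∀ i, ∑ j, w i * w j * (⟪x i - sampleMean x, x j - sampleMean x⟫ / p) =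
        w i * (⟪x i - sampleMean x, a⟫ / p) := fun i => by
      rw [← h1, Finset.mul_sum]
      exact Finset.sum_congr rfl fun j _ => by ring
    simp only [h3]
    rw [← real_inner_self_eq_norm_sq, ha, sum_inner, Finset.sum_div, ← ha]
    exact Finset.sum_congr rfl fun i _ => by rw [real_inner_smul_left]; ring
  simp only [h1, div_pow]
  rw [h2, ← Finset.sum_div, div_mul_div_comm, ← sq]
  exact div_le_div_of_nonneg_right (h.sum_inner_sq_le hn a) (sq_nonneg _)

/-- The non-spiked eigenvalues enter only through their sum: the trace minus the leading eigenvalue.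
-/
theorem scaled_ridgeParam (hn : 2 < n) :
    ridgeParam n lamHat * (n / p) =
      (∑ j, ⟪x j - sampleMean x, x j - sampleMean x⟫ / p - n * lamHat 0 / p) / ((n : ℝ) - 2) := by
  rw [← Finset.sum_div, h.sum_norm_sq (by omega), Finset.range_eq_Ico,
    Finset.sum_eq_sum_Ico_succ_bot (by omega), ridgeParam]
  ring

end IsSamplePCA

/-! ### The model -/

theorem IsEigendecomposition.inner_eq_sum {p : ℕ} {C : Matrix (Fin p) (Fin p) ℝ} {lam : ℕ → ℝ}
    {u : ℕ → Vec p} (h : IsEigendecomposition C lam u) (hp : 0 < p) (a b : Vec p) :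
    ⟪a, b⟫ = ∑ k ∈ Finset.range p, ⟪u k, a⟫ * ⟪u k, b⟫ := by
  have : Nonempty (Fin p) := ⟨⟨0, hp⟩⟩
  let B := basisOfOrthonormalOfCardEqFinrank h.orthonormal (by simp)
  have hB : ⇑B = fun k : Fin p => u k :=
    coe_basisOfOrthonormalOfCardEqFinrank h.orthonormal (by simp)
  let O := B.toOrthonormalBasis (by rw [hB]; exact h.orthonormal)
  have hO : ∀ k, O k = u k := fun k => by
    rw [Module.Basis.coe_toOrthonormalBasis, hB]
  rw [Finset.sum_range, ← O.sum_inner_mul_inner a b]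
  exact Finset.sum_congr rfl fun k _ => by rw [hO, real_inner_comm a]

section Model

variable {Ω : Type*} [MeasurableSpace Ω] {P : Measure Ω} {n : ℕ}
  {X : (p : ℕ) → Fin n → Ω → Vec p} {μ : (p : ℕ) → Vec p}
  {C : (p : ℕ) → Matrix (Fin p) (Fin p) ℝ} {lam : ℕ → ℕ → ℝ} {u : (p : ℕ) → ℕ → Vec p}
  {σsq τsq : ℝ} {τs : ℕ → ℕ → ℝ} {z : ℕ → Fin n → Ω → ℝ} {v : (p : ℕ) → Vec p} {a₁ : ℝ}

/-- The fluctuations of the Gram matrix and of the projections on the reference direction. -/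
def scoreError (τsq : ℝ) (τs : ℕ → ℕ → ℝ) (u : (p : ℕ) → ℕ → Vec p) (z : ℕ → Fin n → Ω → ℝ)
    (v : (p : ℕ) → Vec p) : (Fin n × Fin n) ⊕ Fin n → ℕ → Ω → ℝ
  | .inl ij => fun p ω => ∑ k ∈ Finset.range p, τs p k / p * (z k ij.1 ω * z k ij.2 ω) -
      τsq * if ij.1 = ij.2 then 1 else 0
  | .inr i => fun p ω => ∑ k ∈ Finset.range p,
      (if k = 0 then 0 else √(τs p k) * ⟪u p k, v p⟫ / √p) * z k i ω

theorem ScoreCondition.inner_eq (hspike : SingleSpike n lam σsq τsq τs)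
    (hz : ScoreCondition P X μ lam u z) {p : ℕ} (hp : n < p) {k : ℕ} (hk : k < p) (i : Fin n)
    (ω : Ω) : ⟪u p k, X p i ω - μ p⟫ = √(lam p k) * z k i ω := by
  rw [← hz.truncation p hp k hk i ω, mul_inv_cancel_left₀]
  exact (Real.sqrt_pos.2 (hspike.lam_pos hp hk)).ne'

theorem ScoreCondition.gram_eq (hC : ∀ p, n < p → IsEigendecomposition (C p) (lam p) (u p))
    (hspike : SingleSpike n lam σsq τsq τs) (hz : ScoreCondition P X μ lam u z) {p : ℕ}
    (hp : n < p) (i j : Fin n) (ω : Ω) :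
    ⟪X p i ω - μ p, X p j ω - μ p⟫ / p = σsq * z 0 i ω * z 0 j ω +
      (τsq * (if i = j then 1 else 0) + scoreError τsq τs u z v (.inl (i, j)) p ω) := by
  have hp0 : (p : ℝ) ≠ 0 := Nat.cast_ne_zero.2 (by omega)
  -- Since `lam p 0 / p = σ² + τ₁² / p`, the spike leaves a remainder that completes the bulk sum at
  -- `k = 0`.
  have h1 : ∀ k ∈ Finset.range p, ⟪u p k, X p i ω - μ p⟫ * ⟪u p k, X p j ω - μ p⟫ / p =
      (if k = 0 then σsq * z 0 i ω * z 0 j ω else 0) +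
        τs p k / p * (z k i ω * z k j ω) := by
    intro k hk
    have hk := Finset.mem_range.1 hk
    rw [hz.inner_eq hspike hp hk, hz.inner_eq hspike hp hk, mul_mul_mul_comm,
      Real.mul_self_sqrt (hspike.lam_pos hp hk).le]
    split_ifs with hk0
    · subst hk0
      rw [hspike.spiked p hp]
      field_simp
    · rw [hspike.nonspiked p hp k (by omega) hk]; ring
  rw [(hC p hp).inner_eq_sum (by omega), Finset.sum_div, Finset.sum_congr rfl h1, Finset.sum_add_distrib,
    Finset.sum_ite_eq' , if_pos (Finset.mem_range.2 (by omega)), scoreError]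
  ring

theorem ScoreCondition.spike_eq (hspike : SingleSpike n lam σsq τsq τs)
    (hz : ScoreCondition P X μ lam u z) {p : ℕ} (hp : n < p) (i : Fin n) (ω : Ω) :
    ⟪X p i ω - μ p, u p 0⟫ / √p = √(lam p 0 / p) * z 0 i ω := by
  rw [real_inner_comm, hz.inner_eq hspike hp (by omega), Real.sqrt_div' _ (Nat.cast_nonneg p)]
  ring

theorem ScoreCondition.reference_eq
    (hC : ∀ p, n < p → IsEigendecomposition (C p) (lam p) (u p))
    (hspike : SingleSpike n lam σsq τsq τs) (hz : ScoreCondition P X μ lam u z) {p : ℕ}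
    (hp : n < p) (i : Fin n) (ω : Ω) :
    ⟪X p i ω - μ p, v p⟫ / √p = ⟪v p, u p 0⟫ * (√(lam p 0 / p) * z 0 i ω) +
      scoreError τsq τs u z v (.inr i) p ω := by
  have h1 : ∀ k ∈ Finset.range p, ⟪u p k, X p i ω - μ p⟫ * ⟪u p k, v p⟫ / √p =
      (if k = 0 then ⟪v p, u p 0⟫ * (√(lam p 0 / p) * z 0 i ω) else 0) +
        (if k = 0 then 0 else √(τs p k) * ⟪u p k, v p⟫ / √p) * z k i ω := by
    intro k hk
    have hk := Finset.mem_range.1 hk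
    rw [hz.inner_eq hspike hp hk]
    split_ifs with hk0
    · subst hk0
      rw [Real.sqrt_div' _ (Nat.cast_nonneg p), real_inner_comm]
      ring
    · rw [hspike.nonspiked p hp k (by omega) hk]; ring
  rw [(hC p hp).inner_eq_sum (by omega), Finset.sum_div, Finset.sum_congr rfl h1, Finset.sum_add_distrib,
    Finset.sum_ite_eq', if_pos (Finset.mem_range.2 (by omega)), scoreError]

theorem SingleSpike.tendsto_sqrt (hspike : SingleSpike n lam σsq τsq τs) :
    Tendsto (fun p : ℕ => √(lam p 0 / p)) atTop (𝓝 √σsq) := by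
  obtain ⟨B, hB⟩ := hspike.bounded
  refine Tendsto.sqrt ?_
  have h1 : Tendsto (fun p : ℕ => τs p 0 / p) atTop (𝓝 0) := by
    refine tendsto_of_tendsto_of_tendsto_of_le_of_le' tendsto_const_nhds
      (tendsto_const_div_atTop_nhds_zero_nat B) ?_ ?_
    · filter_upwards [eventually_gt_atTop n] with p hp
      exact div_nonneg (hspike.τs_pos p hp 0 (by omega)).le (Nat.cast_nonneg p)
    · filter_upwards [eventually_gt_atTop n] with p hp
      exact div_le_div_of_nonneg_right (hB p hp 0 (by omega)) (Nat.cast_nonneg p)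
  have h2 := h1.const_add σsq
  rw [add_zero] at h2
  refine h2.congr' ?_
  filter_upwards [eventually_gt_atTop n] with p hp
  have hp0 : (p : ℝ) ≠ 0 := Nat.cast_ne_zero.2 (by omega)
  rw [hspike.spiked p hp]
  field_simp

/-- The squared norm of the projection is `⟪v p, u p 0⟫ ^ 2`, so `a₁` and the signed limit agree up
to sign, and the gain sees only the square. -/
theorem ReferenceCondition.exists_limit (hv : ReferenceCondition n u v a₁)
    (hu : ∀ p, n < p → ‖u p 0‖ = 1) :
    ∃ a : ℝ, Tendsto (fun p => ⟪v p, u p 0⟫) atTop (𝓝 a) ∧ a ^ 2 ≤ 1 ∧ a₁ ^ 2 = a ^ 2 := by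
  obtain ⟨a, ha, hlim⟩ := hv.inner
  refine ⟨a, hlim, by nlinarith [ha.1, ha.2], ?_⟩
  refine tendsto_nhds_unique (hv.projection.pow 2) ((hlim.pow 2).congr' ?_)
  filter_upwards [eventually_gt_atTop n] with p hp
  rw [Submodule.starProjection_unit_singleton ℝ (hu p hp), norm_smul, hu p hp, mul_one,
    Real.norm_eq_abs, sq_abs, real_inner_comm]

variable {lamHat : (p : ℕ) → Ω → ℕ → ℝ} {uHat : (p : ℕ) → Ω → ℕ → Vec p}
  {uARG : (p : ℕ) → Ω → Vec p}

/-- The limits of the sample quantities, as a function of the limiting scores of the spike. -/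
theorem errorFilter_limits (hC : ∀ p, n < p → IsEigendecomposition (C p) (lam p) (u p))
    (hspike : SingleSpike n lam σsq τsq τs) (hz : ScoreCondition P X μ lam u z)
    (hv : ReferenceCondition n u v a₁)
    (hPCA : ∀ p, n < p → ∀ ω, IsSamplePCA (fun i => X p i ω) (u p) (lamHat p ω) (uHat p ω))
    (hARG : ∀ p, n < p → ∀ ω,
      (∃ w, IsARGDirection n (lamHat p ω) (uHat p ω) (v p) (u p 0) w) →
        IsARGDirection n (lamHat p ω) (uHat p ω) (v p) (u p 0) (uARG p ω))
    {ζ : Fin n → ℝ} (hζ : 0 < spikeScatter σsq ζ) {l : Filter (ℕ × Ω)}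
    (hl : l = errorFilter (scoreError τsq τs u z v) (fun ω i => z 0 i ω) ζ) :
    Tendsto (fun q : ℕ × Ω => ⟪uHat q.1 q.2 0, u q.1 0⟫) l
        (𝓝 √(spikeScatter σsq ζ / (spikeScatter σsq ζ + τsq))) ∧
      Tendsto (fun q : ℕ × Ω => ⟪uARG q.1 q.2, u q.1 0⟫) l
        (𝓝 √(spikeScatter σsq ζ / (spikeScatter σsq ζ + τsq) *
          gain τsq a₁ (spikeScatter σsq ζ))) ∧
      ∀ᶠ q in l, ‖uARG q.1 q.2‖ = 1 := by
  have hn : 2 < n := by have := hspike.size; omega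
  have hn0 : n ≠ 0 := by omega
  have hn2 : (0 : ℝ) < n - 2 := by
    have : (2 : ℝ) < n := by exact_mod_cast hn
    linarith
  have hnR : (n : ℝ) ≠ 0 := Nat.cast_ne_zero.2 hn0
  have hτ := hspike.τsq_pos
  have hσ := hspike.σsq_pos
  obtain ⟨a, ha, ha1, haa⟩ := hv.exists_limit fun p hp => (hC p hp).orthonormal.1 ⟨0, by omega⟩
  have hfst : Tendsto Prod.fst l atTop := hl ▸ tendsto_fst_errorFilter _ _ _
  have hpar := hl ▸ tendsto_param_errorFilter (scoreError τsq τs u z v) (fun ω i => z 0 i ω) ζ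
  have hpar' : ∀ i, Tendsto (fun q : ℕ × Ω => z 0 i q.2) l (𝓝 (ζ i)) := tendsto_pi_nhds.1 hpar
  have herr : ∀ r, Tendsto (fun q : ℕ × Ω => scoreError τsq τs u z v r q.1 q.2) l (𝓝 0) :=
    fun r => hl ▸ tendsto_error_errorFilter _ _ _ r
  have hev : ∀ᶠ q in l, n < q.1 := hfst.eventually_gt_atTop n
  have ha' : Tendsto (fun q : ℕ × Ω => ⟪v q.1, u q.1 0⟫) l (𝓝 a) := ha.comp hfst
  have hsq : Tendsto (fun q : ℕ × Ω => √(lam q.1 0 / q.1)) l (𝓝 √σsq) :=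
    hspike.tendsto_sqrt.comp hfst
  have hG : ∀ i j, Tendsto (fun q : ℕ × Ω =>
      ⟪X q.1 i q.2 - μ q.1, X q.1 j q.2 - μ q.1⟫ / q.1) l
      (𝓝 (σsq * ζ i * ζ j + τsq * if i = j then 1 else 0)) := by
    intro i j
    have h1 := (((hpar' i).const_mul σsq).mul (hpar' j)).add
      ((herr (.inl (i, j))).const_add (τsq * if i = j then 1 else 0))
    rw [add_zero] at h1
    refine h1.congr' ?_
    filter_upwards [hev] with q hq using (hz.gram_eq hC hspike hq i j q.2).symm
  set D : ℕ × Ω → Fin n → Fin n → ℝ := fun q i j =>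
    ⟪X q.1 i q.2 - sampleMean (fun i => X q.1 i q.2),
      X q.1 j q.2 - sampleMean (fun i => X q.1 i q.2)⟫ / q.1 with hDdef
  have hD : ∀ i j, Tendsto (fun q => D q i j) l (𝓝 (σsq * center ζ i * center ζ j +
      τsq * ((if i = j then 1 else 0) - (n : ℝ)⁻¹))) := by
    intro i j
    rw [← center_center_spiked hn0]
    refine (tendsto_center (fun k => tendsto_center (fun k' => hG k k') j) i).congr fun q => ?_
    simp only [hDdef]
    rw [inner_sub_sampleMean_sub_sampleMean (fun i => X q.1 i q.2) (μ q.1) hn0]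
    simp only [center_div]
  have hg : ∀ j, Tendsto (fun q : ℕ × Ω =>
      ⟪X q.1 j q.2 - sampleMean (fun i => X q.1 i q.2), u q.1 0⟫ / √q.1) l
      (𝓝 (√σsq * center ζ j)) := by
    intro j
    rw [← center_const_mul]
    refine (tendsto_center (fun k => hsq.mul (hpar' k)) j).congr' ?_
    filter_upwards [hev] with q hq
    rw [inner_sub_sampleMean (fun i => X q.1 i q.2) (μ q.1) _ hn0, ← center_div]
    simp only [hz.spike_eq hspike hq]
  have hh : ∀ j, Tendsto (fun q : ℕ × Ω =>
      ⟪X q.1 j q.2 - sampleMean (fun i => X q.1 i q.2), v q.1⟫ / √q.1) l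
      (𝓝 (a * (√σsq * center ζ j))) := by
    intro j
    rw [← center_const_mul, ← center_const_mul]
    have h1 : ∀ k, Tendsto (fun q : ℕ × Ω => ⟪v q.1, u q.1 0⟫ * (√(lam q.1 0 / q.1) * z 0 k q.2) +
        scoreError τsq τs u z v (.inr k) q.1 q.2) l (𝓝 (a * (√σsq * ζ k))) := fun k => by
      simpa using (ha'.mul (hsq.mul (hpar' k))).add (herr (.inr k))
    refine (tendsto_center h1 j).congr' ?_
    filter_upwards [hev] with q hq
    rw [inner_sub_sampleMean (fun i => X q.1 i q.2) (μ q.1) _ hn0, ← center_div]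
    simp only [hz.reference_eq hC hspike hq]
  have hs := spikeScatter_eq hn0 σsq ζ
  set s := spikeScatter σsq ζ with hsdef
  set y : ℕ × Ω → Fin n → ℝ := fun q j =>
    ⟪X q.1 j q.2 - sampleMean (fun i => X q.1 i q.2), uHat q.1 q.2 0⟫ / √q.1 with hydef
  set L : ℕ × Ω → ℝ := fun q => n * lamHat q.1 q.2 0 / q.1 with hLdef
  have hy : ∀ᶠ q in l, ∑ j, y q j ^ 2 = L q := by
    filter_upwards [hev] with q hq using (hPCA q.1 hq q.2).sum_scaled_sq (by omega)
  have hy0 : ∀ᶠ q in l, ∑ j, y q j = 0 := by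
    refine Eventually.of_forall fun q => ?_
    simp only [hydef]
    rw [← Finset.sum_div]
    simp only [inner_sub_sampleMean (fun i => X q.1 i q.2) (μ q.1) _ hn0]
    rw [sum_center hn0, zero_div]
  have heig : ∀ᶠ q in l, ∑ i, ∑ j, y q i * y q j * D q i j = L q ^ 2 := by
    filter_upwards [hev] with q hq using (hPCA q.1 hq q.2).sum_scaled_gram (by omega)
  have hmax : ∀ᶠ q in l, ∑ j, (∑ i, center ζ i * D q j i) ^ 2 ≤
      L q * ∑ i, ∑ j, center ζ i * center ζ j * D q i j := by
    filter_upwards [hev] with q hq using (hPCA q.1 hq q.2).sum_scaled_rayleigh (by omega) _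
  have hL : Tendsto L l (𝓝 (s + τsq)) := hs ▸ tendsto_leading_eigenvalue hσ.le hτ
    (sum_center hn0 ζ) (hs ▸ hζ) hD hy hy0 heig hmax
  have hq : Tendsto (fun q => (√σsq * ∑ i, y q i * center ζ i) ^ 2) l (𝓝 ((s + τsq) * s)) := by
    simp only [mul_pow, Real.sq_sqrt hσ.le]
    exact tendsto_sq_inner_spike hD hy hy0 heig hL
  obtain ⟨hb, hc⟩ := tendsto_cosines (b := fun q => ⟪uHat q.1 q.2 0, u q.1 0⟫)
    (c := fun q => ⟪uHat q.1 q.2 0, v q.1⟫) hζ hτ hy hL hq hg hh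
    (by filter_upwards [hev] with q hq using (hPCA q.1 hq q.2).sign 0 (by omega))
    (by filter_upwards [hev] with q hq using (hPCA q.1 hq q.2).sum_scaled_mul (by omega) _)
    (by filter_upwards [hev] with q hq using (hPCA q.1 hq q.2).sum_scaled_mul (by omega) _)
  have hr : Tendsto (fun q : ℕ × Ω => ridgeParam n (lamHat q.1 q.2) * (n / q.1)) l (𝓝 τsq) := by
    have h1 := ((tendsto_finsetSum Finset.univ fun j _ => hD j j).sub hL).div_const ((n : ℝ) - 2)
    -- The limiting trace is `s + (n - 1) τ²`; removing the top eigenvalue `s + τ²` leaves `(n - 2)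
    -- τ²`.
    have h2 : (∑ j, (σsq * center ζ j * center ζ j + τsq * ((if j = j then 1 else 0) - (n : ℝ)⁻¹)) -
        (s + τsq)) / ((n : ℝ) - 2) = τsq := by
      simp only [if_true, Finset.sum_add_distrib, mul_assoc, ← Finset.mul_sum, ← sq, ← hs,
        Finset.sum_const, Finset.card_univ, Fintype.card_fin, nsmul_eq_mul]
      rw [div_eq_iff hn2.ne']
      field_simp
      ring
    rw [h2] at h1
    refine h1.congr' ?_
    filter_upwards [hev] with q hq using ((hPCA q.1 hq q.2).scaled_ridgeParam hn).symm
  have hd : Tendsto (fun q : ℕ × Ω => L q - ridgeParam n (lamHat q.1 q.2) * (n / q.1)) l (𝓝 s) := by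
    simpa using hL.sub hr
  have hd' : ∀ q : ℕ × Ω, L q - ridgeParam n (lamHat q.1 q.2) * (n / q.1) =
      (lamHat q.1 q.2 0 - ridgeParam n (lamHat q.1 q.2)) * (n / q.1) := fun q => by
    simp only [hLdef]; ring
  have hκ : Tendsto (fun q : ℕ × Ω => ridgeParam n (lamHat q.1 q.2) /
      (lamHat q.1 q.2 0 - ridgeParam n (lamHat q.1 q.2))) l (𝓝 (τsq / s)) := by
    refine (hr.div hd hζ.ne').congr' ?_
    filter_upwards [hev] with q hq
    have hp0 : (q.1 : ℝ) ≠ 0 := Nat.cast_ne_zero.2 (by omega)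
    simp only [Pi.div_apply]
    rw [hd', mul_div_mul_right _ _ (div_ne_zero hnR hp0)]
  -- As `s / (s + τ²) < 1`, the directions `uHat 0` and `v` stay non-collinear even when `a = ±1`.
  have hc2 : (a * √(s / (s + τsq))) ^ 2 < 1 := by
    have h1 : s / (s + τsq) < 1 := (div_lt_one (by positivity)).2 (by linarith)
    have h2 : 0 < s / (s + τsq) := by positivity
    rw [mul_pow, Real.sq_sqrt h2.le]
    nlinarith
  -- `uARG` is constrained only where some ARG direction exists; nondegeneracy of the limits ensures
  -- this eventually.
  have hgood : ∀ᶠ q in l, IsARGDirection n (lamHat q.1 q.2) (uHat q.1 q.2) (v q.1) (u q.1 0)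
      (uARG q.1 q.2) ∧ ⟪uARG q.1 q.2, u q.1 0⟫ = argCos (ridgeParam n (lamHat q.1 q.2) /
        (lamHat q.1 q.2 0 - ridgeParam n (lamHat q.1 q.2))) ⟪v q.1, u q.1 0⟫
        ⟪uHat q.1 q.2 0, u q.1 0⟫ ⟪uHat q.1 q.2 0, v q.1⟫ := by
    filter_upwards [hev, hr.eventually_const_lt hτ, hd.eventually_const_lt hζ,
      (hc.pow 2).eventually_lt_const hc2] with q h1 h2 h3 h4
    have h5 : ridgeParam n (lamHat q.1 q.2) ≠ 0 := fun h0 => by simp [h0] at h2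
    have h6 : lamHat q.1 q.2 0 ≠ ridgeParam n (lamHat q.1 q.2) := fun h0 => by
      rw [hd', h0, sub_self, zero_mul] at h3
      exact h3.false
    have h7 := (hPCA q.1 h1 q.2).norm_uHat (show 0 < n - 1 by omega)
    have h8 := hARG q.1 h1 q.2 (exists_isARGDirection h7 (hv.unit q.1 h1) h5 h6 h4)
    exact ⟨h8, h8.inner_eq h7 (hv.unit q.1 h1) h5 h6 h4⟩
  refine ⟨hb, ?_, hgood.mono fun q hq => hq.1.unit⟩
  rw [← argCos_limit hζ hτ ha1 haa]
  exact (tendsto_argCos hκ ha' hb hc hc2).congr' (hgood.mono fun q hq => hq.2.symm)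

end Model

/-! ### The gain factor -/

theorem gain_den_pos {τ a s : ℝ} (hτ : 0 < τ) (hs : 0 < s) (ha : a ∈ Set.Icc (0 : ℝ) 1) :
    0 < s ^ 2 * (1 - a ^ 2) + s * τ := by
  have : 0 ≤ 1 - a ^ 2 := by nlinarith [ha.1, ha.2]
  positivity

theorem one_le_gain {τ a s : ℝ} (hτ : 0 < τ) (hs : 0 < s) (ha : a ∈ Set.Icc (0 : ℝ) 1) :
    1 ≤ gain τ a s :=
  le_add_of_nonneg_right (div_nonneg (by positivity) (gain_den_pos hτ hs ha).le)

theorem one_lt_gain {τ a s : ℝ} (hτ : 0 < τ) (hs : 0 < s) (ha : a ∈ Set.Icc (0 : ℝ) 1)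
    (ha0 : 0 < a) : 1 < gain τ a s :=
  lt_add_of_pos_right _ (div_pos (by positivity) (gain_den_pos hτ hs ha))

/-- After clearing denominators the gap is `s τ (s + τ) (1 - a²)`. The bound keeps the limiting
cosine in the interval where arccos is strictly decreasing. -/
theorem ratio_mul_gain_le_one {τ a s : ℝ} (hτ : 0 < τ) (hs : 0 < s)
    (ha : a ∈ Set.Icc (0 : ℝ) 1) : s / (s + τ) * gain τ a s ≤ 1 := by
  have h0 := gain_den_pos hτ hs ha
  have h1 : 0 ≤ 1 - a ^ 2 := by nlinarith [ha.1, ha.2]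
  rw [gain, one_add_div h0.ne', div_mul_div_comm, div_le_one (by positivity)]
  have h2 : 0 ≤ s * τ * (s + τ) * (1 - a ^ 2) := by positivity
  linarith

theorem continuousOn_gain {τ a : ℝ} (hτ : 0 < τ) (ha : a ∈ Set.Icc (0 : ℝ) 1) :
    ContinuousOn (gain τ a) (Set.Ioi 0) :=
  continuousOn_const.add (continuousOn_const.div (by fun_prop)
    fun _ hs => (gain_den_pos hτ hs ha).ne')

theorem continuousOn_ratio {τ : ℝ} (hτ : 0 < τ) :
    ContinuousOn (fun s : ℝ => s / (s + τ)) (Set.Ioi 0) :=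
  continuousOn_id.div (by fun_prop) fun _ hs => (add_pos hs hτ).ne'

end ARG

end

/-! ### Convergence of the cosines and comparison of the angles -/

theorem theorem5 {Ω : Type*} [MeasurableSpace Ω] (P : Measure Ω) [IsProbabilityMeasure P]
    (n : ℕ)
    -- the data and the population parameters in each dimension `p`
    (X : (p : ℕ) → Fin n → Ω → ARG.Vec p)
    (μ : (p : ℕ) → ARG.Vec p) (C : (p : ℕ) → Matrix (Fin p) (Fin p) ℝ)
    (lam : ℕ → ℕ → ℝ) (u : (p : ℕ) → ℕ → ARG.Vec p)
    (hX : ∀ p, n < p → ARG.IsSample P (X p) (μ p) (C p))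
    (hC : ∀ p, n < p → ARG.IsEigendecomposition (C p) (lam p) (u p))
    -- spiked covariance model with a single spike
    (σsq τsq : ℝ) (τs : ℕ → ℕ → ℝ) (hspike : ARG.SingleSpike n lam σsq τsq τs)
    -- standardized scores
    (z : ℕ → Fin n → Ω → ℝ) (hz : ARG.ScoreCondition P X μ lam u z)
    -- the reference direction
    (v : (p : ℕ) → ARG.Vec p) (a₁ : ℝ) (hv : ARG.ReferenceCondition n u v a₁)
    -- sample principal component variances and directions
    (lamHat : (p : ℕ) → Ω → ℕ → ℝ) (uHat : (p : ℕ) → Ω → ℕ → ARG.Vec p)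
    (hPCA : ∀ p, n < p → ∀ ω,
      ARG.IsSamplePCA (fun i => X p i ω) (u p) (lamHat p ω) (uHat p ω))
    -- the ARG estimator, wherever it exists
    (uARG : (p : ℕ) → Ω → ARG.Vec p)
    (hARG : ∀ p, n < p → ∀ ω,
      (∃ w, ARG.IsARGDirection n (lamHat p ω) (uHat p ω) (v p) (u p 0) w) →
        ARG.IsARGDirection n (lamHat p ω) (uHat p ω) (v p) (u p 0) (uARG p ω))
    -- the limiting random variable
    (s : Ω → ℝ) (hs : ∀ ω, s ω = ARG.spikeScatter σsq (fun i => z 0 i ω)) :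
    TendstoInMeasure P (fun p ω => ⟪uARG p ω, u p 0⟫) atTop
      (fun ω => √((s ω / (s ω + τsq)) * ARG.gain τsq a₁ (s ω))) ∧
    -- `uARG` is asymptotically closer to `u p 0` than `uHat`
    TendstoInMeasure P (fun p ω => ⟪uHat p ω 0, u p 0⟫) atTop
      (fun ω => √(s ω / (s ω + τsq))) ∧
    TendstoInMeasure P (fun p ω => ⟪uARG p ω, u p 0⟫ / ⟪uHat p ω 0, u p 0⟫) atTop
      (fun ω => √(ARG.gain τsq a₁ (s ω))) ∧
    (∀ᵐ ω ∂P, 1 ≤ ARG.gain τsq a₁ (s ω)) ∧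
    (∀ ε : ℝ, 0 < ε → Tendsto (fun p => P {ω | InnerProductGeometry.angle (uHat p ω 0) (u p 0) + ε
      ≤ InnerProductGeometry.angle (uARG p ω) (u p 0)}) atTop (𝓝 0)) ∧
    (0 < a₁ → (∀ᵐ ω ∂P, 1 < ARG.gain τsq a₁ (s ω)) ∧
      Tendsto (fun p => P {ω | InnerProductGeometry.angle (uHat p ω 0) (u p 0)
        ≤ InnerProductGeometry.angle (uARG p ω) (u p 0)}) atTop (𝓝 0)) := by
  have hn : 2 < n := by have := hspike.size; omega
  have hn0 : n ≠ 0 := by omega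
  have hτ := hspike.τsq_pos
  have hu : ∀ p, n < p → ‖u p 0‖ = 1 := fun p hp => (hC p hp).orthonormal.1 ⟨0, by omega⟩
  have hmom := hz.scoreMoments hX hC hspike
  have he : ∀ r, TendstoInMeasure P (ARG.scoreError τsq τs u z v r) atTop 0 := by
    rintro (⟨i, j⟩ | i)
    · exact hmom.tendstoInMeasure_gram hspike i j
    · exact hmom.tendstoInMeasure_reference hspike (fun p hp => (hC p hp).orthonormal) hv.unit i
  have hY : Measurable fun ω i => z 0 i ω := measurable_pi_iff.2 fun i => hmom.measurable 0 i
  have hcont := ARG.continuous_spikeScatter hn0 σsq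
  have hU : IsOpen {ζ : Fin n → ℝ | 0 < ARG.spikeScatter σsq ζ} := isOpen_lt continuous_const hcont
  have hpos : ∀ᵐ ω ∂P, 0 < ARG.spikeScatter σsq fun i => z 0 i ω := by
    filter_upwards [hmom.ae_ne (show (⟨0, by omega⟩ : Fin n) ≠ ⟨1, by omega⟩ by simp)] with ω hω
    exact ARG.spikeScatter_pos hspike.σsq_pos hω
  obtain rfl : s = fun ω => ARG.spikeScatter σsq fun i => z 0 i ω := funext hs
  have hmaps : Set.MapsTo (ARG.spikeScatter σsq) {ζ : Fin n → ℝ | 0 < ARG.spikeScatter σsq ζ}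
      (Set.Ioi 0) := fun _ h => h
  have hratio := (ARG.continuousOn_ratio hτ).comp hcont.continuousOn hmaps
  have hgain := (ARG.continuousOn_gain hτ hv.mem_Icc).comp hcont.continuousOn hmaps
  have hlim := fun ζ (hζ : 0 < ARG.spikeScatter σsq ζ) =>
    ARG.errorFilter_limits hC hspike hz hv hPCA hARG hζ rfl
  have hr0 : ∀ {t : ℝ}, 0 < t → 0 < t / (t + τsq) := fun ht => by positivity
  -- For unit vectors the angle is the arccos of the inner product; `uARG` is known to be a unit
  -- vector only eventually.
  have hangle : ∀ ζ, 0 < ARG.spikeScatter σsq ζ →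
      Tendsto (fun q : ℕ × Ω => InnerProductGeometry.angle (uHat q.1 q.2 0) (u q.1 0))
        (ARG.errorFilter (ARG.scoreError τsq τs u z v) (fun ω i => z 0 i ω) ζ)
        (𝓝 (Real.arccos √(ARG.spikeScatter σsq ζ / (ARG.spikeScatter σsq ζ + τsq)))) ∧
      Tendsto (fun q : ℕ × Ω => InnerProductGeometry.angle (uARG q.1 q.2) (u q.1 0))
        (ARG.errorFilter (ARG.scoreError τsq τs u z v) (fun ω i => z 0 i ω) ζ)
        (𝓝 (Real.arccos √(ARG.spikeScatter σsq ζ / (ARG.spikeScatter σsq ζ + τsq) *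
          ARG.gain τsq a₁ (ARG.spikeScatter σsq ζ)))) := by
    intro ζ hζ
    obtain ⟨h1, h2, h3⟩ := hlim ζ hζ
    have hev := (ARG.tendsto_fst_errorFilter (ARG.scoreError τsq τs u z v)
      (fun ω i => z 0 i ω) ζ).eventually_gt_atTop n
    constructor
    · refine ((Real.continuous_arccos.tendsto _).comp h1).congr' ?_
      filter_upwards [hev] with q hq
      rw [Function.comp_apply, InnerProductGeometry.angle, hu q.1 hq,
        (hPCA q.1 hq q.2).norm_uHat (by omega), mul_one, div_one]
    · refine ((Real.continuous_arccos.tendsto _).comp h2).congr' ?_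
      filter_upwards [hev, h3] with q hq hq'
      rw [Function.comp_apply, InnerProductGeometry.angle, hu q.1 hq, hq', mul_one, div_one]
  refine ⟨?_, ?_, ?_, ?_, ?_, ?_⟩
  · exact ARG.tendstoInMeasure_of_errorFilter (F := fun ζ => √(ARG.spikeScatter σsq ζ /
      (ARG.spikeScatter σsq ζ + τsq) * ARG.gain τsq a₁ (ARG.spikeScatter σsq ζ)))
      he hY hU hpos (hratio.mul hgain).sqrt fun ζ hζ => (hlim ζ hζ).2.1
  · exact ARG.tendstoInMeasure_of_errorFilter (F := fun ζ => √(ARG.spikeScatter σsq ζ /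
      (ARG.spikeScatter σsq ζ + τsq))) he hY hU hpos hratio.sqrt fun ζ hζ => (hlim ζ hζ).1
  · refine ARG.tendstoInMeasure_of_errorFilter
      (F := fun ζ => √(ARG.gain τsq a₁ (ARG.spikeScatter σsq ζ)))
      he hY hU hpos hgain.sqrt fun ζ hζ => ?_
    have h0 := Real.sqrt_pos.2 (hr0 hζ)
    have h1 := (hlim ζ hζ).2.1.div (hlim ζ hζ).1 h0.ne'
    rwa [Real.sqrt_mul (hr0 hζ).le, mul_div_cancel_left₀ _ h0.ne'] at h1
  · filter_upwards [hpos] with ω hω using ARG.one_le_gain hτ hω hv.mem_Icc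
  · intro ε hε
    refine ARG.tendsto_measure_zero_of_errorFilter he hY hU hpos fun ζ hζ => ?_
    obtain ⟨h1, h2⟩ := hangle ζ hζ
    have hle : Real.arccos √(ARG.spikeScatter σsq ζ / (ARG.spikeScatter σsq ζ + τsq) *
        ARG.gain τsq a₁ (ARG.spikeScatter σsq ζ)) ≤
        Real.arccos √(ARG.spikeScatter σsq ζ / (ARG.spikeScatter σsq ζ + τsq)) :=
      Real.arccos_le_arccos (Real.sqrt_le_sqrt
        (le_mul_of_one_le_right (hr0 hζ).le (ARG.one_le_gain hτ hζ hv.mem_Icc)))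
    filter_upwards [h2.eventually_lt (h1.add_const ε) (by linarith)] with q hq
    simpa using hq
  · intro ha
    refine ⟨?_, ?_⟩
    · filter_upwards [hpos] with ω hω using ARG.one_lt_gain hτ hω hv.mem_Icc ha
    · refine ARG.tendsto_measure_zero_of_errorFilter he hY hU hpos fun ζ hζ => ?_
      obtain ⟨h1, h2⟩ := hangle ζ hζ
      have hlt : √(ARG.spikeScatter σsq ζ / (ARG.spikeScatter σsq ζ + τsq)) <
          √(ARG.spikeScatter σsq ζ / (ARG.spikeScatter σsq ζ + τsq) *
          ARG.gain τsq a₁ (ARG.spikeScatter σsq ζ)) :=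
        Real.sqrt_lt_sqrt (hr0 hζ).le
          (lt_mul_of_one_lt_right (hr0 hζ) (ARG.one_lt_gain hτ hζ hv.mem_Icc ha))
      have hle1 : √(ARG.spikeScatter σsq ζ / (ARG.spikeScatter σsq ζ + τsq) *
          ARG.gain τsq a₁ (ARG.spikeScatter σsq ζ)) ≤ 1 :=
        Real.sqrt_le_one.2 (ARG.ratio_mul_gain_le_one hτ hζ hv.mem_Icc)
      have hlt' := Real.strictAntiOn_arccos ⟨(neg_one_lt_zero.le.trans (Real.sqrt_nonneg _)), hlt.le.trans hle1⟩
        ⟨(neg_one_lt_zero.le.trans (Real.sqrt_nonneg _)), hle1⟩ hlt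
      -- The limiting angles are strictly ordered at each `ζ`, so no margin `ε` is needed.
      filter_upwards [h2.eventually_lt h1 hlt'] with q hq
      simpa using hq
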